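/- Work over $\mathbf{C}$ and let $d \ge 4$. Let $$C=\{[s^d:s^{d-1}t:\cdots:t^d] : [s:t]\in\mathbf{P}^1\}\subseteq\mathbf{P}^d$$ be the rational normal curve of degree $d$, let $\Sigma\subseteq\mathbf{P}^d$ be its first secant variety, i.e. the Zariski closure of the union of the lines spanned by two distinct points of $C$, and let $T$ be its tangent developable surface, i.e. the union of the tangent lines to $C$ in $\mathbf{P}^d$. Let $\operatorname{Aut}(\Sigma)$ be the group of all automorphisms of the projective variety $\Sigma$ (biregular maps $\Sigma\to\Sigma$ over $\mathbf{C}$), acting on the points of $\Sigma$. Then there are exactly three $\operatorname{Aut}(\Sigma)$-orbits on $\Sigma$, namely $C$, $T\setminus C$ and $\Sigma\setminus T$. -/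

import Mathlib

open scoped LinearAlgebra.Projectivization

noncomputable section

namespace SecantRNC

/-! ### Classical projective varieties over the complex numbers

Projective space is the set of lines of `ι → ℂ`, with `MvPolynomial ι ℂ` as homogeneous
coordinate ring. For a homogeneous polynomial, vanishing at a nonzero vector depends only on the
point of projective space represented by that vector. -/

/-- The Zariski closure of a subset `S` of projective space: the common zeros of all homogeneous
polynomials that vanish on `S`. -/
def zariskiClosure {ι : Type*} (S : Set (ℙ ℂ (ι → ℂ))) : Set (ℙ ℂ (ι → ℂ)) :=
  {x | ∀ (n : ℕ) (F : MvPolynomial ι ℂ), F.IsHomogeneous n →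
    (∀ y ∈ S, MvPolynomial.eval y.rep F = 0) → MvPolynomial.eval x.rep F = 0}

/-- Regular maps (morphisms of varieties) `X → Y` between subsets of projective spaces: every
point `mk u` of `X` has a basic Zariski open neighbourhood `{G ≠ 0}` in `X` on which `f` is given
by a tuple `F` of homogeneous polynomials of one common degree without common zeros there. -/
def IsRegularMap {ι κ : Type*} (X : Set (ℙ ℂ (ι → ℂ))) (Y : Set (ℙ ℂ (κ → ℂ)))
    (f : X → Y) : Prop :=
  ∀ (u : ι → ℂ) (hu : u ≠ 0), Projectivization.mk ℂ u hu ∈ X →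
    ∃ (m e : ℕ) (G : MvPolynomial ι ℂ) (F : κ → MvPolynomial ι ℂ),
      G.IsHomogeneous m ∧ (∀ j, (F j).IsHomogeneous e) ∧ MvPolynomial.eval u G ≠ 0 ∧
      ∀ (v : ι → ℂ) (hv : v ≠ 0) (hvX : Projectivization.mk ℂ v hv ∈ X),
        MvPolynomial.eval v G ≠ 0 →
          ∃ h : (fun j => MvPolynomial.eval v (F j)) ≠ 0,
            (f ⟨Projectivization.mk ℂ v hv, hvX⟩ : ℙ ℂ (κ → ℂ)) =
              Projectivization.mk ℂ (fun j => MvPolynomial.eval v (F j)) h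

theorem IsRegularMap.id {ι : Type*} (X : Set (ℙ ℂ (ι → ℂ))) :
    IsRegularMap X X (fun x => x) := by
  intro u hu _
  refine ⟨0, 1, 1, fun j => MvPolynomial.X j, MvPolynomial.isHomogeneous_one _ _,
    fun j => MvPolynomial.isHomogeneous_X _ _, by simp, ?_⟩
  intro v hv hvX _
  have e : (fun j => MvPolynomial.eval v (MvPolynomial.X j : MvPolynomial ι ℂ)) = v := by
    funext j; simp
  refine ⟨by rw [e]; exact hv, ?_⟩
  simp only [e]

theorem IsRegularMap.comp {ι κ τ : Type*} {X : Set (ℙ ℂ (ι → ℂ))} {Y : Set (ℙ ℂ (κ → ℂ))}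
    {Z : Set (ℙ ℂ (τ → ℂ))} {g : Y → Z} {f : X → Y} (hg : IsRegularMap Y Z g)
    (hf : IsRegularMap X Y f) : IsRegularMap X Z (fun x => g (f x)) := by
  intro u hu huX
  obtain ⟨m, e, G, F, hG, hF, hGu, H⟩ := hf u hu huX
  obtain ⟨hFu, hfu⟩ := H u hu huX hGu
  obtain ⟨m', e', G', F', hG', hF', hGu', H'⟩ := hg _ hFu (by rw [← hfu]; exact (f _).2)
  have ev : ∀ (v : ι → ℂ) (P : MvPolynomial κ ℂ),
      MvPolynomial.eval v (MvPolynomial.aeval F P) =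
        MvPolynomial.eval (fun j => MvPolynomial.eval v (F j)) P := by
    intro v P
    induction P using MvPolynomial.induction_on with
    | C a => simp
    | add p q hp hq => simp only [map_add, hp, hq]
    | mul_X p i hp => simp only [map_mul, hp, MvPolynomial.aeval_X, MvPolynomial.eval_X]
  refine ⟨m + e * m', e * e', G * MvPolynomial.aeval F G',
    fun j => MvPolynomial.aeval F (F' j), hG.mul (hG'.aeval F hF),
    fun j => (hF' j).aeval F hF, ?_, ?_⟩
  · rw [map_mul, ev]
    exact mul_ne_zero hGu hGu'
  · intro v hv hvX hGv
    rw [map_mul, ev] at hGv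
    obtain ⟨hFv, hfv⟩ := H v hv hvX (left_ne_zero_of_mul hGv)
    have hmem : Projectivization.mk ℂ _ hFv ∈ Y := by rw [← hfv]; exact (f _).2
    obtain ⟨hFv', hgv⟩ := H' _ hFv hmem (right_ne_zero_of_mul hGv)
    have hf2 : f ⟨Projectivization.mk ℂ v hv, hvX⟩ = ⟨_, hmem⟩ := Subtype.ext hfv
    simp only [ev]
    exact ⟨hFv', by rw [hf2]; exact hgv⟩

/-- `Aut(X)`: the group of all biregular self-maps of `X` (isomorphisms of varieties `X → X`). -/
def Aut {ι : Type*} (X : Set (ℙ ℂ (ι → ℂ))) : Subgroup (Equiv.Perm X) where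
  carrier := {φ | IsRegularMap X X φ ∧ IsRegularMap X X φ.symm}
  mul_mem' := fun ha hb => ⟨ha.1.comp hb.1, hb.2.comp ha.2⟩
  one_mem' := ⟨IsRegularMap.id X, IsRegularMap.id X⟩
  inv_mem' := fun ha => ⟨ha.2, ha.1⟩

/-- The set of `Aut(X)`-orbits on `X`, each regarded as a subset of projective space. -/
def autOrbits {ι : Type*} (X : Set (ℙ ℂ (ι → ℂ))) : Set (Set (ℙ ℂ (ι → ℂ))) :=
  Set.range fun x : X => Subtype.val '' MulAction.orbit (Aut X) x

/-! ### The rational normal curve, its secant variety and its tangent developable -/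

/-- The affine cone over the Veronese map, `(s, t) ↦ (s^d, s^(d-1) t, …, t^d)`. -/
def veroneseVec (d : ℕ) (p : Fin 2 → ℂ) : Fin (d + 1) → ℂ :=
  fun k => p 0 ^ (d - (k : ℕ)) * p 1 ^ (k : ℕ)

theorem veroneseVec_ne_zero (d : ℕ) {p : Fin 2 → ℂ} (hp : p ≠ 0) : veroneseVec d p ≠ 0 := by
  intro h
  apply hp
  have h0 := congrFun h 0
  have h1 := congrFun h (Fin.last d)
  simp only [veroneseVec, Fin.val_zero, Fin.val_last, Nat.sub_zero, Nat.sub_self, pow_zero,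
    mul_one, one_mul, Pi.zero_apply] at h0 h1
  funext i
  fin_cases i
  · exact eq_zero_of_pow_eq_zero h0
  · exact eq_zero_of_pow_eq_zero h1

/-- The rational normal curve `C = v_d(ℙ¹)` of degree `d` in `ℙ^d`. -/
def rationalNormalCurve (d : ℕ) : Set (ℙ ℂ (Fin (d + 1) → ℂ)) :=
  {x | ∃ (p : Fin 2 → ℂ) (hp : p ≠ 0),
    x = Projectivization.mk ℂ (veroneseVec d p) (veroneseVec_ne_zero d hp)}

/-- The union of the lines spanned by two distinct points of `C`. -/
def secantLines (d : ℕ) : Set (ℙ ℂ (Fin (d + 1) → ℂ)) :=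
  {z | ∃ x ∈ rationalNormalCurve d, ∃ y ∈ rationalNormalCurve d, x ≠ y ∧
    z.submodule ≤ x.submodule ⊔ y.submodule}

/-- The first secant variety `Σ` of `C`. -/
def secantVariety (d : ℕ) : Set (ℙ ℂ (Fin (d + 1) → ℂ)) :=
  zariskiClosure (secantLines d)

/-- The tangent developable surface `T`, the union of the tangent lines to `C`. The tangent line
at the point represented by `veroneseVec d p` is the projectivization of the image of the
differential of the (polynomial) cone map `veroneseVec d` at `p`. -/
def tangentDevelopable (d : ℕ) : Set (ℙ ℂ (Fin (d + 1) → ℂ)) :=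
  {z | ∃ p : Fin 2 → ℂ, p ≠ 0 ∧
    z.submodule ≤ LinearMap.range (fderiv ℂ (veroneseVec d) p).toLinearMap}

end SecantRNC

end

open scoped LinearAlgebra.Projectivization

noncomputable section

namespace SecantRNC

/-! ### Homogeneous polynomials and points of projective space -/

/-! Two things are needed: enough automorphisms to join points within each stratum, and invariants
that keep the strata apart.

The secant variety Σ consists exactly of the points on secant lines and tangent lines
(`mk_mem_secantVariety_iff`). Its points make the three-column Hankel matrix drop rank, and a kernel
vector of that matrix is a second-order linear recurrence on the coordinates. Distinct
characteristic roots in P¹ give a point on a secant line, a double root a point on a tangent line.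
The group GL₂ acts linearly on the ambient space through binary forms of degree d and preserves Σ.
Since it is transitive on bases of ℂ², it is transitive on C, on T \ C and on Σ \ T.

Conversely, an arbitrary automorphism φ preserves C, because C is the set of points where the
Zariski tangent space of Σ is the whole ambient space. The secants through a point of C already span
everything, whereas at points of T \ C and Σ \ T some Hankel minor has nonzero differential; this
uses d ≥ 4 (`aut_mem_rationalNormalCurve`).

Both T \ C and Σ \ T are smooth on Σ, so a global argument separates them (`aut_standard`,
`aut_isSecantVec`). Composing with elements of GL₂, one may assume that φ fixes v(1,0) and v(0,1).
The cone over C with vertex v(1,0) is parametrized by (x, y, a) ↦ v(x,y) + a v(1,0), with weights 1,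
1, d. By unique factorization φ lifts there to one tuple F of weighted homogeneous polynomials.
Bijectivity of φ on C forces F to have weight d. The only monomials of weight d free of x are y^d
and a, so F(0,1,1) = F(0,1,0) + F(0,0,1), a sum of nonzero multiples of v(0,1) and v(1,0). Hence Σ \
T is preserved, and then so is T \ C. -/

theorem eval_scale_of_isWeightedHomogeneous {ι : Type*} {w : ι → ℕ} {P : MvPolynomial ι ℂ} {n : ℕ}
    (hP : P.IsWeightedHomogeneous w n) (c : ℂ) (v : ι → ℂ) :
    MvPolynomial.eval (fun i => c ^ w i * v i) P = c ^ n * MvPolynomial.eval v P := by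
  rw [MvPolynomial.eval_eq, MvPolynomial.eval_eq, Finset.mul_sum]
  refine Finset.sum_congr rfl fun m hm => ?_
  have h : Finsupp.weight w m = n := hP (MvPolynomial.mem_support_iff.1 hm)
  have h' : ∑ i ∈ m.support, w i * m i = n := by
    rw [← h, Finsupp.weight_apply, Finsupp.sum]
    exact Finset.sum_congr rfl fun i _ => by rw [smul_eq_mul, mul_comm]
  simp only [mul_pow, Finset.prod_mul_distrib, ← pow_mul]
  rw [Finset.prod_pow_eq_pow_sum, h']
  ring

theorem eval_smul_of_isHomogeneous {ι : Type*} {P : MvPolynomial ι ℂ} {n : ℕ}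
    (hP : P.IsHomogeneous n) (c : ℂ) (v : ι → ℂ) :
    MvPolynomial.eval (c • v) P = c ^ n * MvPolynomial.eval v P := by
  rw [← eval_scale_of_isWeightedHomogeneous (w := 1) hP c v]
  simp [Pi.smul_def]

theorem eval_rep_mk_eq_zero_iff {ι : Type*} {P : MvPolynomial ι ℂ} {n : ℕ}
    (hP : P.IsHomogeneous n) {v : ι → ℂ} (hv : v ≠ 0) :
    MvPolynomial.eval (Projectivization.mk ℂ v hv).rep P = 0 ↔ MvPolynomial.eval v P = 0 := by
  obtain ⟨a, ha⟩ := Projectivization.exists_smul_eq_mk_rep ℂ v hv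
  rw [← ha, Units.smul_def, eval_smul_of_isHomogeneous hP]
  simp

/-- Homogeneity makes vanishing independent of the representative, so the arbitrary choice `rep` can
be replaced by all nonzero vectors. -/
theorem mk_mem_zariskiClosure_iff {ι : Type*} {S : Set (ℙ ℂ (ι → ℂ))} {u : ι → ℂ} (hu : u ≠ 0) :
    Projectivization.mk ℂ u hu ∈ zariskiClosure S ↔
      ∀ (n : ℕ) (P : MvPolynomial ι ℂ), P.IsHomogeneous n →
        (∀ (v : ι → ℂ) (hv : v ≠ 0), Projectivization.mk ℂ v hv ∈ S → MvPolynomial.eval v P = 0) →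
          MvPolynomial.eval u P = 0 := by
  refine forall_congr' fun n => forall_congr' fun P => forall_congr' fun hP => ?_
  rw [eval_rep_mk_eq_zero_iff hP]
  refine imp_congr_left ⟨fun h v hv hS => ?_, fun h y hy => ?_⟩
  · exact (eval_rep_mk_eq_zero_iff hP hv).1 (h _ hS)
  · induction y using Projectivization.ind with
    | h v hv => exact (eval_rep_mk_eq_zero_iff hP hv).2 (h v hv hy)

theorem differentiable_eval {ι : Type*} [Fintype ι] (P : MvPolynomial ι ℂ) :
    Differentiable ℂ (fun v : ι → ℂ => MvPolynomial.eval v P) := by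
  induction P using MvPolynomial.induction_on with
  | C a => simp
  | add p q hp hq => simp only [map_add]; exact hp.add hq
  | mul_X p i hp =>
    simp only [map_mul, MvPolynomial.eval_X]
    exact hp.mul (differentiable_apply i)

/-! ### The Veronese cone map and its differential -/

/-- The value of the differential of the Veronese cone map at `p` on `w`. -/
def tangentVec (d : ℕ) (p w : Fin 2 → ℂ) : Fin (d + 1) → ℂ :=
  -- Where an exponent `d - k - 1` or `k - 1` is truncated, its coefficient is zero.
  fun k => ((d - (k : ℕ) : ℕ) : ℂ) * p 0 ^ (d - (k : ℕ) - 1) * p 1 ^ (k : ℕ) * w 0 +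
    (k : ℂ) * p 0 ^ (d - (k : ℕ)) * p 1 ^ ((k : ℕ) - 1) * w 1

theorem hasFDerivAt_veroneseVec (d : ℕ) (p : Fin 2 → ℂ) :
    ∃ L : (Fin 2 → ℂ) →L[ℂ] (Fin (d + 1) → ℂ), HasFDerivAt (veroneseVec d) L p ∧
      ∀ w, L w = tangentVec d p w := by
  have h : ∀ k : Fin (d + 1), HasFDerivAt (fun q : Fin 2 → ℂ => veroneseVec d q k) _ p := fun k =>
    ((ContinuousLinearMap.proj (R := ℂ) (φ := fun _ : Fin 2 => ℂ) 0).hasFDerivAt.pow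
      (d - (k : ℕ))).mul
      ((ContinuousLinearMap.proj (R := ℂ) (φ := fun _ : Fin 2 => ℂ) 1).hasFDerivAt.pow (k : ℕ))
  refine ⟨_, hasFDerivAt_pi.2 h, fun w => ?_⟩
  funext k
  simp [tangentVec]
  ring

theorem fderiv_veroneseVec_apply (d : ℕ) (p w : Fin 2 → ℂ) :
    fderiv ℂ (veroneseVec d) p w = tangentVec d p w := by
  obtain ⟨L, hL, h⟩ := hasFDerivAt_veroneseVec d p
  rw [hL.fderiv, h]

theorem differentiableAt_veroneseVec (d : ℕ) (p : Fin 2 → ℂ) :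
    DifferentiableAt ℂ (veroneseVec d) p :=
  let ⟨_, hL, _⟩ := hasFDerivAt_veroneseVec d p
  hL.differentiableAt

theorem veroneseVec_smul (d : ℕ) (c : ℂ) (p : Fin 2 → ℂ) :
    veroneseVec d (c • p) = c ^ d • veroneseVec d p := by
  funext k
  have hk : c ^ d = c ^ (d - (k : ℕ)) * c ^ (k : ℕ) := by
    rw [← pow_add, Nat.sub_add_cancel (by omega)]
  simp only [veroneseVec, Pi.smul_apply, smul_eq_mul, hk, mul_pow]
  ring

/-- Scalars have `d`-th roots, so the affine cone over the curve is the image of `veroneseVec`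
itself. -/
theorem exists_veroneseVec_eq_smul {d : ℕ} (hd : d ≠ 0) (c : ℂ) (p : Fin 2 → ℂ) :
    ∃ c' : ℂ, c • veroneseVec d p = veroneseVec d (c' • p) ∧ (c ≠ 0 → c' ≠ 0) := by
  obtain ⟨z, hz⟩ := IsAlgClosed.exists_pow_nat_eq c (Nat.pos_of_ne_zero hd)
  exact ⟨z, by rw [veroneseVec_smul, hz], fun h h0 => h (by rw [← hz, h0, zero_pow hd])⟩

theorem veroneseVec_zero {d : ℕ} (hd : d ≠ 0) : veroneseVec d 0 = 0 := by
  simpa [hd] using veroneseVec_smul d 0 0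

/-- Euler's identity: the tangent line at a point of the curve contains that point. -/
theorem tangentVec_self (d : ℕ) (p : Fin 2 → ℂ) :
    tangentVec d p p = (d : ℂ) • veroneseVec d p := by
  funext k
  have hk : (k : ℕ) ≤ d := by omega
  simp only [tangentVec, veroneseVec, Pi.smul_apply, smul_eq_mul]
  have h1 : ((d - (k : ℕ) : ℕ) : ℂ) * p 0 ^ (d - (k : ℕ) - 1) * p 0 =
      ((d - (k : ℕ) : ℕ) : ℂ) * p 0 ^ (d - (k : ℕ)) := by
    rcases Nat.eq_zero_or_pos (d - (k : ℕ)) with h | h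
    · simp [h]
    · rw [mul_assoc, ← pow_succ, Nat.sub_add_cancel h]
  have h2 : ((k : ℕ) : ℂ) * p 1 ^ ((k : ℕ) - 1) * p 1 = ((k : ℕ) : ℂ) * p 1 ^ (k : ℕ) := by
    rcases Nat.eq_zero_or_pos (k : ℕ) with h | h
    · simp [h]
    · rw [mul_assoc, ← pow_succ, Nat.sub_add_cancel h]
  have h3 : ((d - (k : ℕ) : ℕ) : ℂ) = d - k := by push_cast [hk]; ring
  linear_combination p 1 ^ (k : ℕ) * h1 + p 0 ^ (d - (k : ℕ)) * h2 +
    p 0 ^ (d - (k : ℕ)) * p 1 ^ (k : ℕ) * h3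

theorem tangentVec_smul (d : ℕ) (p : Fin 2 → ℂ) (c : ℂ) (w : Fin 2 → ℂ) :
    tangentVec d p (c • w) = c • tangentVec d p w := by
  simp only [← fderiv_veroneseVec_apply, map_smul]

/-- A functional killing every v(1,t) is a polynomial in t with no nonzero values, so its
coefficients vanish. Linear maps are therefore determined on the curve. -/
theorem span_veroneseVec (d : ℕ) : Submodule.span ℂ (Set.range (veroneseVec d)) = ⊤ := by
  by_contra hne
  obtain ⟨f, hf0, hf⟩ := Submodule.exists_le_ker_of_lt_top _ (lt_top_iff_ne_top.2 hne)
  apply hf0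
  set c : Fin (d + 1) → ℂ := fun k => f (Pi.single k 1) with hc
  have hfc : ∀ x, f x = ∑ k, x k * c k := by
    intro x
    conv_lhs => rw [pi_eq_sum_univ' x]
    simp [hc]
  let P : Polynomial ℂ := ∑ k : Fin (d + 1), Polynomial.C (c k) * Polynomial.X ^ (k : ℕ)
  have hP : P = 0 := by
    refine Polynomial.funext fun t => ?_
    have := hf (Submodule.subset_span ⟨![1, t], rfl⟩)
    rw [LinearMap.mem_ker, hfc] at this
    simp only [veroneseVec] at this
    simp only [P, Polynomial.eval_finsetSum, Polynomial.eval_mul, Polynomial.eval_C,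
      Polynomial.eval_pow, Polynomial.eval_X, Polynomial.eval_zero, ← this]
    refine Finset.sum_congr rfl fun k _ => ?_
    simp [mul_comm]
  have hck : ∀ k, c k = 0 := by
    intro k
    have h := congrArg (fun Q : Polynomial ℂ => Q.coeff (k : ℕ)) hP
    simpa [P, Polynomial.finsetSum_coeff, Polynomial.coeff_X_pow, Fin.val_inj] using h
  ext x
  simp [hc] at hck ⊢
  exact hck x

/-- A homogeneous form of degree `d` in two variables is a linear form in the Veronese
coordinates. -/
theorem exists_eval_eq_sum_veroneseVec {d : ℕ} {P : MvPolynomial (Fin 2) ℂ}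
    (hP : P.IsHomogeneous d) :
    ∃ f : (Fin (d + 1) → ℂ) →ₗ[ℂ] ℂ, ∀ p, f (veroneseVec d p) = MvPolynomial.eval p P := by
  have h : ∀ m ∈ P.support, m 0 + m 1 = d := by
    intro m hm
    by_contra h
    refine (MvPolynomial.mem_support_iff.1 hm) (hP.coeff_eq_zero ?_)
    rwa [Finsupp.degree_eq_sum, Fin.sum_univ_two]
  -- `Fin.ofNat` reduces modulo `d + 1`; this is harmless because `m 1 ≤ d` on the support.
  refine ⟨∑ m ∈ P.support, MvPolynomial.coeff m P •
    LinearMap.proj (R := ℂ) (φ := fun _ : Fin (d + 1) => ℂ) (Fin.ofNat (d + 1) (m 1)), fun p => ?_⟩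
  rw [MvPolynomial.eval_eq', LinearMap.sum_apply]
  refine Finset.sum_congr rfl fun m hm => ?_
  have hm' := h m hm
  have h1 : m 1 % (d + 1) = m 1 := Nat.mod_eq_of_lt (by omega)
  simp only [LinearMap.smul_apply, LinearMap.proj_apply, veroneseVec, Fin.ofNat, h1,
    Fin.prod_univ_two, smul_eq_mul]
  rw [show d - m 1 = m 0 by omega]

/-- The coordinates of v(gp) are forms of degree `d` in p, hence linear in v(p): this is the action
of g on binary forms. -/
theorem exists_linearMap_veroneseVec (d : ℕ) (g : Matrix (Fin 2) (Fin 2) ℂ) :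
    ∃ A : (Fin (d + 1) → ℂ) →ₗ[ℂ] (Fin (d + 1) → ℂ),
      ∀ p, A (veroneseVec d p) = veroneseVec d (g.mulVec p) := by
  let ℓ : Fin 2 → MvPolynomial (Fin 2) ℂ := fun i => ∑ j, MvPolynomial.C (g i j) * MvPolynomial.X j
  have hℓ : ∀ i, (ℓ i).IsHomogeneous 1 := fun i =>
    MvPolynomial.IsHomogeneous.sum _ _ _ fun j _ => MvPolynomial.isHomogeneous_C_mul_X _ _
  have hev : ∀ i p, MvPolynomial.eval p (ℓ i) = g.mulVec p i := by
    intro i p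
    simp [ℓ, Matrix.mulVec, dotProduct]
  have hF : ∀ k : Fin (d + 1), (ℓ 0 ^ (d - (k : ℕ)) * ℓ 1 ^ (k : ℕ)).IsHomogeneous d := by
    intro k
    have := ((hℓ 0).pow (d - (k : ℕ))).mul ((hℓ 1).pow (k : ℕ))
    rwa [one_mul, one_mul, Nat.sub_add_cancel (by omega)] at this
  choose f hf using fun k => exists_eval_eq_sum_veroneseVec (hF k)
  refine ⟨LinearMap.pi f, fun p => ?_⟩
  funext k
  simp only [LinearMap.pi_apply, hf, map_mul, map_pow, hev, veroneseVec]

/-- The linear automorphism of `ℂ^(d+1)` induced by an invertible matrix of size two. -/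
theorem exists_linearEquiv_veroneseVec (d : ℕ) (g h : Matrix (Fin 2) (Fin 2) ℂ) (hgh : g * h = 1) :
    ∃ A : (Fin (d + 1) → ℂ) ≃ₗ[ℂ] (Fin (d + 1) → ℂ),
      (∀ p, A (veroneseVec d p) = veroneseVec d (g.mulVec p)) ∧
      ∀ p, A.symm (veroneseVec d p) = veroneseVec d (h.mulVec p) := by
  have hhg : h * g = 1 := mul_eq_one_comm.1 hgh
  obtain ⟨A, hA⟩ := exists_linearMap_veroneseVec d g
  obtain ⟨B, hB⟩ := exists_linearMap_veroneseVec d h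
  refine ⟨LinearEquiv.ofLinearMap A B ?_ ?_, hA, hB⟩
  · refine LinearMap.ext_on_range (v := veroneseVec d) (span_veroneseVec d) fun p => ?_
    simp only [LinearMap.comp_apply, LinearMap.id_apply, hA, hB, Matrix.mulVec_mulVec, hgh,
      Matrix.one_mulVec]
  · refine LinearMap.ext_on_range (v := veroneseVec d) (span_veroneseVec d) fun p => ?_
    simp only [LinearMap.comp_apply, LinearMap.id_apply, hA, hB, Matrix.mulVec_mulVec, hhg,
      Matrix.one_mulVec]

/-- Differentiate A ∘ v = v ∘ g at p. -/
theorem map_tangentVec {d : ℕ} {g : Matrix (Fin 2) (Fin 2) ℂ}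
    {A : (Fin (d + 1) → ℂ) →ₗ[ℂ] (Fin (d + 1) → ℂ)}
    (hA : ∀ p, A (veroneseVec d p) = veroneseVec d (g.mulVec p)) (p w : Fin 2 → ℂ) :
    A (tangentVec d p w) = tangentVec d (g.mulVec p) (g.mulVec w) := by
  let A' := LinearMap.toContinuousLinearMap A
  let g' := LinearMap.toContinuousLinearMap g.mulVecLin
  have h1 : HasFDerivAt (fun p => A' (veroneseVec d p)) _ p :=
    A'.hasFDerivAt.comp p (differentiableAt_veroneseVec d p).hasFDerivAt
  have h2 : HasFDerivAt (fun p => veroneseVec d (g' p)) _ p :=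
    (differentiableAt_veroneseVec d (g' p)).hasFDerivAt.comp p g'.hasFDerivAt
  have h3 : (fun p => A' (veroneseVec d p)) = fun p => veroneseVec d (g' p) := funext hA
  rw [h3] at h1
  have := DFunLike.congr_fun (h1.unique h2) w
  simpa [fderiv_veroneseVec_apply, A', g'] using this

/-! ### Points of the curve, of its tangent lines and of its secant lines -/

theorem exists_pair_det_ne_zero {p : Fin 2 → ℂ} (hp : p ≠ 0) :
    ∃ q : Fin 2 → ℂ, p 0 * q 1 - p 1 * q 0 ≠ 0 := by
  by_cases h : p 0 = 0
  · refine ⟨![1, 0], ?_⟩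
    have : p 1 ≠ 0 := fun h1 => hp (by funext i; fin_cases i <;> assumption)
    simpa [h] using this
  · exact ⟨![0, 1], by simpa using h⟩

theorem exists_smul_of_pair_det_eq_zero {p w : Fin 2 → ℂ} (hp : p ≠ 0)
    (h : p 0 * w 1 - p 1 * w 0 = 0) : ∃ c : ℂ, w = c • p := by
  by_cases h0 : p 0 = 0
  · have h1 : p 1 ≠ 0 := fun h1 => hp (by funext i; fin_cases i <;> assumption)
    refine ⟨w 1 / p 1, ?_⟩
    have h2 : w 0 = 0 := by simpa [h0, h1] using h
    funext i
    fin_cases i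
    · simp [h0, h2]
    · simp [h1]
  · refine ⟨w 0 / p 0, ?_⟩
    funext i
    fin_cases i
    · simp [h0]
    · simp only [Fin.mk_one, Pi.smul_apply, smul_eq_mul]
      field_simp
      linear_combination h

/-- Injectivity of the Veronese map on P¹. The first two and the last two coordinates show that the
determinant is killed by powers of both `p 0` and `p 1`. -/
theorem pair_det_eq_zero_of_veroneseVec_eq_smul {d : ℕ} (hd : d ≠ 0) {p q : Fin 2 → ℂ} {a : ℂ}
    (h : veroneseVec d p = a • veroneseVec d q) : p 0 * q 1 - p 1 * q 0 = 0 := by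
  obtain ⟨n, rfl⟩ := Nat.exists_eq_succ_of_ne_zero hd
  have e : ∀ k : Fin (n + 1 + 1), p 0 ^ (n + 1 - (k : ℕ)) * p 1 ^ (k : ℕ) =
      a * (q 0 ^ (n + 1 - (k : ℕ)) * q 1 ^ (k : ℕ)) := fun k => congrFun h k
  have e0 := e 0
  have e1 := e 1
  have en := e (Fin.last n).castSucc
  have en1 := e (Fin.last (n + 1))
  simp only [Fin.val_zero, Fin.val_one, Fin.val_last, Fin.val_castSucc, Nat.sub_zero,
    Nat.add_sub_cancel, Nat.sub_self, Nat.add_sub_cancel_left, pow_zero, mul_one, one_mul,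
    pow_one] at e0 e1 en en1
  by_contra hne
  have h0 : p 0 ^ n * (p 0 * q 1 - p 1 * q 0) = 0 := by
    linear_combination q 1 * e0 - q 0 * e1
  have h1 : p 1 ^ n * (p 0 * q 1 - p 1 * q 0) = 0 := by
    linear_combination q 1 * en - q 0 * en1
  have h0' := eq_zero_of_pow_eq_zero ((mul_eq_zero.1 h0).resolve_right hne)
  have h1' := eq_zero_of_pow_eq_zero ((mul_eq_zero.1 h1).resolve_right hne)
  exact hne (by simp [h0', h1'])

theorem mk_mem_rationalNormalCurve_iff {d : ℕ} (hd : d ≠ 0) {u : Fin (d + 1) → ℂ} (hu : u ≠ 0) :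
    Projectivization.mk ℂ u hu ∈ rationalNormalCurve d ↔ ∃ p, u = veroneseVec d p := by
  constructor
  · rintro ⟨p, hp, h⟩
    obtain ⟨a, ha⟩ := (Projectivization.mk_eq_mk_iff' ℂ _ _ _ _).1 h
    obtain ⟨c, hc, -⟩ := exists_veroneseVec_eq_smul hd a p
    exact ⟨c • p, by rw [← ha, hc]⟩
  · rintro ⟨p, rfl⟩
    exact ⟨p, fun h => hu (by rw [h, veroneseVec_zero hd]), rfl⟩

theorem mk_mem_tangentDevelopable_iff {d : ℕ} {u : Fin (d + 1) → ℂ} (hu : u ≠ 0) :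
    Projectivization.mk ℂ u hu ∈ tangentDevelopable d ↔
      ∃ p, p ≠ 0 ∧ ∃ w, u = tangentVec d p w := by
  refine exists_congr fun p => and_congr_right fun _ => ?_
  rw [Projectivization.submodule_mk, Submodule.span_singleton_le_iff_mem, LinearMap.mem_range]
  refine exists_congr fun w => ?_
  rw [← fderiv_veroneseVec_apply]
  exact eq_comm

/-- Vectors in the cone over a secant line, away from the curve. -/
def IsSecantVec (d : ℕ) (u : Fin (d + 1) → ℂ) : Prop :=
  ∃ p q : Fin 2 → ℂ, p 0 * q 1 - p 1 * q 0 ≠ 0 ∧ u = veroneseVec d p + veroneseVec d q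

theorem exists_of_mk_mem_secantLines {d : ℕ} {u : Fin (d + 1) → ℂ} (hu : u ≠ 0)
    (h : Projectivization.mk ℂ u hu ∈ secantLines d) :
    ∃ (p q : Fin 2 → ℂ) (a b : ℂ), u = a • veroneseVec d p + b • veroneseVec d q := by
  obtain ⟨_, ⟨p, hp, rfl⟩, _, ⟨q, hq, rfl⟩, -, hz⟩ := h
  simp only [Projectivization.submodule_mk, Submodule.span_singleton_le_iff_mem,
    ← Submodule.span_insert] at hz
  obtain ⟨a, b, h⟩ := Submodule.mem_span_pair.1 hz
  exact ⟨p, q, a, b, h.symm⟩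

theorem mk_mem_secantLines {d : ℕ} (hd : d ≠ 0) {p q : Fin 2 → ℂ}
    (hpq : p 0 * q 1 - p 1 * q 0 ≠ 0) {a b : ℂ} {u : Fin (d + 1) → ℂ} (hu : u ≠ 0)
    (h : u = a • veroneseVec d p + b • veroneseVec d q) :
    Projectivization.mk ℂ u hu ∈ secantLines d := by
  have hp : p ≠ 0 := by rintro rfl; simp at hpq
  have hq : q ≠ 0 := by rintro rfl; simp at hpq
  refine ⟨_, ⟨p, hp, rfl⟩, _, ⟨q, hq, rfl⟩, fun he => ?_, ?_⟩
  · obtain ⟨c, hc⟩ := (Projectivization.mk_eq_mk_iff' ℂ _ _ _ _).1 he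
    exact hpq (pair_det_eq_zero_of_veroneseVec_eq_smul hd hc.symm)
  · simp only [Projectivization.submodule_mk, Submodule.span_singleton_le_iff_mem,
      ← Submodule.span_insert]
    exact Submodule.mem_span_pair.2 ⟨a, b, h.symm⟩

theorem isSecantVec_of_smul_add_smul {d : ℕ} (hd : d ≠ 0) {p q : Fin 2 → ℂ}
    (hpq : p 0 * q 1 - p 1 * q 0 ≠ 0) {a b : ℂ} (ha : a ≠ 0) (hb : b ≠ 0) :
    IsSecantVec d (a • veroneseVec d p + b • veroneseVec d q) := by
  obtain ⟨s, hs, hs0⟩ := exists_veroneseVec_eq_smul hd a p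
  obtain ⟨t, ht, ht0⟩ := exists_veroneseVec_eq_smul hd b q
  refine ⟨s • p, t • q, ?_, by rw [hs, ht]⟩
  have : s * t * (p 0 * q 1 - p 1 * q 0) ≠ 0 := mul_ne_zero (mul_ne_zero (hs0 ha) (ht0 hb)) hpq
  convert this using 1
  simp only [Pi.smul_apply, smul_eq_mul]
  ring

/-- The cone over the tangent developable. -/
def IsTangentVec (d : ℕ) (u : Fin (d + 1) → ℂ) : Prop :=
  ∃ p, p ≠ 0 ∧ ∃ w, u = tangentVec d p w

theorem isTangentVec_smul_veroneseVec {d : ℕ} (hd : d ≠ 0) {p : Fin 2 → ℂ} (hp : p ≠ 0) (a : ℂ) :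
    IsTangentVec d (a • veroneseVec d p) := by
  refine ⟨p, hp, (a / d) • p, ?_⟩
  rw [tangentVec_smul, tangentVec_self, smul_smul, div_mul_cancel₀ _ (Nat.cast_ne_zero.2 hd)]

theorem isTangentVec_or_isSecantVec {d : ℕ} (hd : d ≠ 0) {p q : Fin 2 → ℂ}
    (hpq : p 0 * q 1 - p 1 * q 0 ≠ 0) (a b : ℂ) :
    IsTangentVec d (a • veroneseVec d p + b • veroneseVec d q) ∨
      IsSecantVec d (a • veroneseVec d p + b • veroneseVec d q) := by
  have hp : p ≠ 0 := by rintro rfl; simp at hpq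
  have hq : q ≠ 0 := by rintro rfl; simp at hpq
  by_cases ha : a = 0
  · left
    rw [ha, zero_smul, zero_add]
    exact isTangentVec_smul_veroneseVec hd hq b
  by_cases hb : b = 0
  · left
    rw [hb, zero_smul, add_zero]
    exact isTangentVec_smul_veroneseVec hd hp a
  exact .inr (isSecantVec_of_smul_add_smul hd hpq ha hb)

/-! ### Hankel matrices -/

/-- The Hankel matrix with three columns of a vector of length `d + 1`. -/
def hankel {R : Type*} (d : ℕ) (x : Fin (d + 1) → R) : Matrix (Fin (d - 1)) (Fin 3) R :=
  Matrix.of fun i a => x ⟨(i : ℕ) + a, by omega⟩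

/-- The maximal minors of the generic Hankel matrix with three columns. -/
def hankelMinor (d : ℕ) (r : Fin 3 → Fin (d - 1)) : MvPolynomial (Fin (d + 1)) ℂ :=
  ((hankel d MvPolynomial.X).submatrix r id).det

theorem isHomogeneous_hankelMinor (d : ℕ) (r : Fin 3 → Fin (d - 1)) :
    (hankelMinor d r).IsHomogeneous 3 := by
  have h : ∀ i j k : Fin (d + 1), ((MvPolynomial.X i * MvPolynomial.X j * MvPolynomial.X k :
      MvPolynomial (Fin (d + 1)) ℂ)).IsHomogeneous 3 := fun i j k =>
    ((MvPolynomial.isHomogeneous_X _ i).mul (MvPolynomial.isHomogeneous_X _ j)).mul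
      (MvPolynomial.isHomogeneous_X _ k)
  rw [hankelMinor, Matrix.det_fin_three]
  exact (((((h _ _ _).sub (h _ _ _)).sub (h _ _ _)).add (h _ _ _)).add (h _ _ _)).sub (h _ _ _)

theorem eval_hankelMinor {d : ℕ} (r : Fin 3 → Fin (d - 1)) (x : Fin (d + 1) → ℂ) :
    MvPolynomial.eval x (hankelMinor d r) = ((hankel d x).submatrix r id).det := by
  rw [hankelMinor, RingHom.map_det]
  congr 1
  ext i j
  simp [hankel]

/-- The Hankel matrix of a Veronese vector has rank at most one, so that of a combination of two has
rank at most two. -/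
theorem eval_hankelMinor_secant {d : ℕ} (r : Fin 3 → Fin (d - 1)) (p q : Fin 2 → ℂ) (a b : ℂ) :
    MvPolynomial.eval (a • veroneseVec d p + b • veroneseVec d q) (hankelMinor d r) = 0 := by
  have key : ∀ (i : Fin 3) (j : Fin 3), ((hankel d (a • veroneseVec d p + b • veroneseVec d q)).submatrix
      r id) i j = a * (p 0 ^ (d - 2 - (r i : ℕ)) * p 1 ^ (r i : ℕ)) *
        (p 0 ^ (2 - (j : ℕ)) * p 1 ^ (j : ℕ)) +
      b * (q 0 ^ (d - 2 - (r i : ℕ)) * q 1 ^ (r i : ℕ)) *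
        (q 0 ^ (2 - (j : ℕ)) * q 1 ^ (j : ℕ)) := by
    intro i j
    have e : d - ((r i : ℕ) + j) = (d - 2 - (r i : ℕ)) + (2 - (j : ℕ)) := by omega
    simp only [hankel, Matrix.submatrix_apply, id, Matrix.of_apply, veroneseVec, Pi.add_apply,
      Pi.smul_apply, smul_eq_mul, e, pow_add]
    ring
  rw [eval_hankelMinor, Matrix.det_fin_three]
  simp only [key]
  ring

/-- Without a kernel the matrix has rank three, and three independent rows give a nonzero minor. -/
theorem exists_mulVec_eq_zero_of_minors_eq_zero {m : ℕ} {M : Matrix (Fin m) (Fin 3) ℂ}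
    (h : ∀ r : Fin 3 → Fin m, (M.submatrix r id).det = 0) : ∃ c ≠ 0, M.mulVec c = 0 := by
  by_contra! hc
  have hinj : Function.Injective M.mulVecLin := by
    rw [← LinearMap.ker_eq_bot, LinearMap.ker_eq_bot']
    intro c hc0
    by_contra hne
    exact hc c hne hc0
  have hrank : M.rank = 3 := by
    rw [Matrix.rank, LinearMap.finrank_range_of_inj hinj]
    simp
  obtain ⟨f, hf, -, hli⟩ := Submodule.exists_fun_fin_finrank_span_eq ℂ (Set.range M.row)
  have h3 : 3 = Module.finrank ℂ (Submodule.span ℂ (Set.range M.row)) := by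
    exact hrank.symm.trans M.rank_eq_finrank_span_row
  choose r hr using fun i : Fin 3 => hf (Fin.cast h3 i)
  have hli' : LinearIndependent ℂ (M.submatrix r id).row := by
    have := hli.comp (Fin.cast h3) (Fin.cast_injective h3)
    rwa [show f ∘ Fin.cast h3 = (M.submatrix r id).row from funext fun i => (hr i).symm] at this
  have := Matrix.linearIndependent_rows_iff_isUnit.1 hli'
  rw [Matrix.isUnit_iff_isUnit_det, h r] at this
  simp at this

/-- A kernel vector is a recurrence with constant coefficients, solved by its characteristic roots
in P¹; the root (0,1) at infinity occurs when `c 2 = 0`. -/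
theorem isTangentVec_or_isSecantVec_of_recurrence {d : ℕ} (hd : 2 ≤ d) {x : Fin (d + 1) → ℂ}
    {c : Fin 3 → ℂ} (hc : c ≠ 0) (h : (hankel d x).mulVec c = 0) :
    IsTangentVec d x ∨ IsSecantVec d x := by
  have hd0 : d ≠ 0 := by omega
  have hrec : ∀ (i : ℕ) (hi : i + 2 < d + 1),
      x ⟨i, by omega⟩ * c 0 + x ⟨i + 1, by omega⟩ * c 1 + x ⟨i + 2, hi⟩ * c 2 = 0 := by
    intro i hi
    have := congrFun h ⟨i, by omega⟩
    simpa [hankel, Matrix.mulVec, dotProduct, Fin.sum_univ_three] using this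
  by_cases h2 : c 2 = 0
  · by_cases h1 : c 1 = 0
    · have h0 : c 0 ≠ 0 := fun h0 => hc (by funext i; fin_cases i <;> assumption)
      left
      -- Double root at infinity: only the last two coordinates survive, and the differential at
      -- (0,1) sends w to `w 0` and `d * w 1` there.
      refine ⟨![0, 1], by simp, ![x ⟨d - 1, by omega⟩, x ⟨d, by omega⟩ / d], ?_⟩
      funext ⟨k, hk⟩
      rcases (by omega : k + 2 < d + 1 ∨ k = d - 1 ∨ k = d) with hk' | rfl | rfl
      · have := hrec k hk'
        simp only [h1, h2, mul_zero, add_zero, mul_eq_zero, h0, or_false] at this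
        rw [this]
        have e1 : d - k - 1 ≠ 0 := by omega
        have e2 : d - k ≠ 0 := by omega
        simp [tangentVec, e1, e2]
      · have e : d - (d - 1) = 1 := by omega
        simp [tangentVec, e]
      · have e : (k : ℂ) ≠ 0 := Nat.cast_ne_zero.2 hd0
        simp only [tangentVec, Nat.sub_self]
        simp
        field_simp
    -- One finite root and one at infinity: geometric except in the last coordinate.
    · set r := -(c 0 / c 1) with hr
      have geo : ∀ (i : ℕ) (hi : i < d), x ⟨i, by omega⟩ = x 0 * r ^ i := by
        intro i
        induction i with
        | zero => intro; simp
        | succ n ih =>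
          intro hi
          have h' := hrec n (by omega)
          rw [h2, ih (by omega)] at h'
          rw [hr, pow_succ, ← hr]
          rw [hr]
          field_simp
          rw [← hr]
          linear_combination h'
      have hx : x = x 0 • veroneseVec d ![1, r] +
          (x (Fin.last d) - x 0 * r ^ d) • veroneseVec d ![0, 1] := by
        funext ⟨k, hk⟩
        rcases (by omega : k < d ∨ k = d) with hk' | rfl
        · rw [geo k hk']
          have : d - k ≠ 0 := by omega
          simp [veroneseVec, this]
        · simp [veroneseVec, Fin.last]
      rw [hx]
      exact isTangentVec_or_isSecantVec hd0 (by simp) _ _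
  · obtain ⟨r, s, h1, h0⟩ : ∃ r s : ℂ, c 1 = -(c 2) * (r + s) ∧ c 0 = c 2 * (r * s) := by
      obtain ⟨z, hz⟩ := IsAlgClosed.exists_pow_nat_eq (discrim (c 2) (c 1) (c 0)) two_pos
      rw [discrim] at hz
      refine ⟨(-c 1 + z) / (2 * c 2), (-c 1 - z) / (2 * c 2), ?_, ?_⟩
      · field_simp
        ring
      · field_simp
        linear_combination hz
    have rec' : ∀ (i : ℕ) (hi : i + 2 < d + 1),
        x ⟨i + 2, hi⟩ = (r + s) * x ⟨i + 1, by omega⟩ - r * s * x ⟨i, by omega⟩ := by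
      intro i hi
      have h' := hrec i hi
      rw [h1, h0] at h'
      refine mul_left_cancel₀ h2 ?_
      linear_combination h'
    have det : ∀ f : ℕ → ℂ, f 0 = x ⟨0, by omega⟩ → f 1 = x ⟨1, by omega⟩ →
        (∀ i, f (i + 2) = (r + s) * f (i + 1) - r * s * f i) →
          ∀ (i : ℕ) (hi : i < d + 1), x ⟨i, hi⟩ = f i := by
      intro f hf0 hf1 hf i
      induction i using Nat.strong_induction_on with
      | _ i ih =>
        intro hi
        match i, ih, hi with
        | 0, _, _ => exact hf0.symm
        | 1, _, _ => exact hf1.symm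
        | i + 2, ih, hi =>
          rw [rec' i hi, ih i (by omega) (by omega), ih (i + 1) (by omega) (by omega), hf]
    by_cases hrs : r = s
    · left
      subst hrs
      set α := x ⟨0, by omega⟩ with hα
      set β := x ⟨1, by omega⟩ - α * r with hβ
      -- The direction is `(α / d)` times (1,r) plus `β` times (0,1). By Euler the first part
      -- contributes the terms `α * r ^ k`, the second the terms `β * k * r ^ (k - 1)`.
      refine ⟨![1, r], fun h => by simpa using congrFun h 0, ![α / d, β + r * (α / d)], ?_⟩
      have hf := det (fun i => α * r ^ i + β * (i * r ^ (i - 1))) (by simp [hα])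
        (by simp [hβ]) (fun i => by
          rcases i with _ | i
          · simp; ring
          · simp only [Nat.add_sub_cancel]
            push_cast
            ring)
      have hdc : (d : ℂ) ≠ 0 := Nat.cast_ne_zero.2 hd0
      funext ⟨k, hk⟩
      rw [hf k hk]
      simp only [tangentVec, Matrix.cons_val_zero, Matrix.cons_val_one, one_pow, mul_one]
      rw [Nat.cast_sub (by omega : k ≤ d)]
      have hk1 : (k : ℂ) * r ^ (k - 1) * r = k * r ^ k := by
        rcases k with _ | k
        · simp
        · rw [Nat.add_sub_cancel]; ring
      field_simp
      linear_combination -α * hk1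
    · have hrs' : s - r ≠ 0 := sub_ne_zero.2 (Ne.symm hrs)
      set β := (x ⟨1, by omega⟩ - r * x ⟨0, by omega⟩) / (s - r) with hβ
      set α := x ⟨0, by omega⟩ - β with hα
      have hβ' : β * (s - r) = x ⟨1, by omega⟩ - r * x ⟨0, by omega⟩ := by
        rw [hβ]; field_simp
      have hf := det (fun i => α * r ^ i + β * s ^ i) (by simp [hα])
        (by simp only [pow_one, hα]; linear_combination hβ') (fun i => by ring)
      have hx : x = α • veroneseVec d ![1, r] + β • veroneseVec d ![1, s] := by
        funext ⟨k, hk⟩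
        rw [hf k hk]
        simp [veroneseVec]
      rw [hx]
      exact isTangentVec_or_isSecantVec hd0 (by simpa using hrs') _ _

/-! ### The secant variety is the union of the secant lines and the tangent lines -/

/-- A tangent vector is the limit of the chords (v(p + tw) − v(p))/t, and polynomials are
continuous. If w is proportional to p, the point is on the curve and lies on a secant line already.
-/
theorem eval_eq_zero_of_isTangentVec {d : ℕ} (hd : d ≠ 0) {u : Fin (d + 1) → ℂ}
    (hu : IsTangentVec d u) (hu0 : u ≠ 0) {P : MvPolynomial (Fin (d + 1)) ℂ}
    (h : ∀ (v : Fin (d + 1) → ℂ) (hv : v ≠ 0), Projectivization.mk ℂ v hv ∈ secantLines d →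
      MvPolynomial.eval v P = 0) : MvPolynomial.eval u P = 0 := by
  obtain ⟨p, hp, w, rfl⟩ := hu
  by_cases hpw : p 0 * w 1 - p 1 * w 0 = 0
  · obtain ⟨c, rfl⟩ := exists_smul_of_pair_det_eq_zero hp hpw
    obtain ⟨q, hq⟩ := exists_pair_det_ne_zero hp
    refine h _ hu0 (mk_mem_secantLines hd hq (a := c * d) (b := 0) hu0 ?_)
    rw [tangentVec_smul, tangentVec_self, smul_smul, zero_smul, add_zero]
  · have hder : HasDerivAt (fun t : ℂ => veroneseVec d (p + t • w)) (tangentVec d p w) 0 := by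
      have h1 : HasFDerivAt (veroneseVec d) (fderiv ℂ (veroneseVec d) p) (p + (0 : ℂ) • w) := by
        simpa using (differentiableAt_veroneseVec d p).hasFDerivAt
      have h2 : HasDerivAt (fun t : ℂ => p + t • w) ((1 : ℂ) • w) 0 :=
        ((hasDerivAt_id (0 : ℂ)).smul_const w).const_add p
      have h3 := h1.comp_hasDerivAt 0 h2
      rwa [one_smul, fderiv_veroneseVec_apply] at h3
    have hlim := hasDerivAt_iff_tendsto_slope_zero.1 hder
    have hlim' := ((differentiable_eval P).continuous.tendsto _).comp hlim
    refine tendsto_nhds_unique (hlim'.congr' ?_) tendsto_const_nhds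
    filter_upwards [self_mem_nhdsWithin] with t ht
    have ht : t ≠ 0 := ht
    have hdet : p 0 * (p + t • w) 1 - p 1 * (p + t • w) 0 ≠ 0 := by
      have : t * (p 0 * w 1 - p 1 * w 0) ≠ 0 := mul_ne_zero ht hpw
      convert this using 1
      simp only [Pi.add_apply, Pi.smul_apply, smul_eq_mul]
      ring
    simp only [zero_add, zero_smul, add_zero, Function.comp_apply]
    refine h _ ?_ (mk_mem_secantLines hd hdet (a := -t⁻¹) (b := t⁻¹) _ ?_)
    · intro h0
      rw [smul_eq_zero_iff_right (inv_ne_zero ht), sub_eq_zero] at h0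
      exact hdet (pair_det_eq_zero_of_veroneseVec_eq_smul hd (a := 1) (by rw [one_smul, h0]))
    · rw [smul_sub, neg_smul]
      abel

theorem IsSecantVec.ne_zero {d : ℕ} (hd : d ≠ 0) {u : Fin (d + 1) → ℂ} (hu : IsSecantVec d u) :
    u ≠ 0 := by
  obtain ⟨p, q, hpq, rfl⟩ := hu
  intro h
  refine hpq (pair_det_eq_zero_of_veroneseVec_eq_smul hd (a := -1) ?_)
  rw [neg_one_smul]
  exact eq_neg_of_add_eq_zero_left h

theorem eval_hankelMinor_of_mk_mem {d : ℕ} {u : Fin (d + 1) → ℂ} (hu : u ≠ 0)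
    (h : Projectivization.mk ℂ u hu ∈ secantVariety d) (r : Fin 3 → Fin (d - 1)) :
    MvPolynomial.eval u (hankelMinor d r) = 0 := by
  rw [secantVariety, mk_mem_zariskiClosure_iff] at h
  refine h 3 _ (isHomogeneous_hankelMinor d r) fun v hv hvS => ?_
  obtain ⟨p, q, a, b, rfl⟩ := exists_of_mk_mem_secantLines hv hvS
  exact eval_hankelMinor_secant r p q a b

theorem mk_mem_secantVariety_iff {d : ℕ} (hd : 2 ≤ d) {u : Fin (d + 1) → ℂ} (hu : u ≠ 0) :
    Projectivization.mk ℂ u hu ∈ secantVariety d ↔ IsTangentVec d u ∨ IsSecantVec d u := by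
  have hd0 : d ≠ 0 := by omega
  constructor
  · intro h
    obtain ⟨c, hc, hc0⟩ := exists_mulVec_eq_zero_of_minors_eq_zero (M := hankel d u) fun r => by
      rw [← eval_hankelMinor]
      exact eval_hankelMinor_of_mk_mem hu h r
    exact isTangentVec_or_isSecantVec_of_recurrence hd hc hc0
  · rw [secantVariety, mk_mem_zariskiClosure_iff]
    rintro (h | ⟨p, q, hpq, h⟩) n P - hP
    · exact eval_eq_zero_of_isTangentVec hd0 h hu hP
    · exact hP u hu (mk_mem_secantLines hd0 hpq (a := 1) (b := 1) hu (by rw [h, one_smul, one_smul]))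

/-! ### Linear automorphisms -/

theorem exists_matrix_pair {p q : Fin 2 → ℂ} (hpq : p 0 * q 1 - p 1 * q 0 ≠ 0) :
    ∃ g h : Matrix (Fin 2) (Fin 2) ℂ, g * h = 1 ∧ g.mulVec p = ![1, 0] ∧ g.mulVec q = ![0, 1] := by
  let M : Matrix (Fin 2) (Fin 2) ℂ := !![p 0, q 0; p 1, q 1]
  have hM : IsUnit M.det := by
    rw [isUnit_iff_ne_zero, Matrix.det_fin_two_of]
    convert hpq using 1
    ring
  have e0 : M.mulVec ![1, 0] = p := by
    funext i
    fin_cases i <;> simp [M, Matrix.mulVec, dotProduct]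
  have e1 : M.mulVec ![0, 1] = q := by
    funext i
    fin_cases i <;> simp [M, Matrix.mulVec, dotProduct]
  refine ⟨M⁻¹, M, Matrix.nonsing_inv_mul _ hM, ?_, ?_⟩
  · conv_lhs => rw [← e0]
    rw [Matrix.mulVec_mulVec, Matrix.nonsing_inv_mul _ hM, Matrix.one_mulVec]
  · conv_lhs => rw [← e1]
    rw [Matrix.mulVec_mulVec, Matrix.nonsing_inv_mul _ hM, Matrix.one_mulVec]

section

variable {d : ℕ} {g h : Matrix (Fin 2) (Fin 2) ℂ} {A : (Fin (d + 1) → ℂ) →ₗ[ℂ] (Fin (d + 1) → ℂ)}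

theorem IsTangentVec.map (hhg : h * g = 1)
    (hA : ∀ p, A (veroneseVec d p) = veroneseVec d (g.mulVec p)) {u : Fin (d + 1) → ℂ}
    (hu : IsTangentVec d u) : IsTangentVec d (A u) := by
  obtain ⟨p, hp, w, rfl⟩ := hu
  refine ⟨g.mulVec p, fun h0 => hp ?_, g.mulVec w, map_tangentVec hA p w⟩
  rw [← Matrix.one_mulVec p, ← hhg, ← Matrix.mulVec_mulVec, h0, Matrix.mulVec_zero]

theorem IsSecantVec.map (hhg : h * g = 1)
    (hA : ∀ p, A (veroneseVec d p) = veroneseVec d (g.mulVec p)) {u : Fin (d + 1) → ℂ}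
    (hu : IsSecantVec d u) : IsSecantVec d (A u) := by
  obtain ⟨p, q, hpq, rfl⟩ := hu
  refine ⟨g.mulVec p, g.mulVec q, ?_, by rw [map_add, hA, hA]⟩
  have hg : g.det ≠ 0 := by
    intro h0
    have := congrArg Matrix.det hhg
    simp [h0] at this
  have : g.det * (p 0 * q 1 - p 1 * q 0) ≠ 0 := mul_ne_zero hg hpq
  convert this using 1
  simp only [Matrix.det_fin_two, Matrix.mulVec, dotProduct, Fin.sum_univ_two]
  ring

end

theorem isRegularMap_of_linearMap {ι : Type*} [Fintype ι] [DecidableEq ι]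
    {X : Set (ℙ ℂ (ι → ℂ))} {f : X → X} (A : (ι → ℂ) →ₗ[ℂ] (ι → ℂ)) (hA : Function.Injective A)
    (hf : ∀ x, (f x : ℙ ℂ (ι → ℂ)) = Projectivization.map A hA x) : IsRegularMap X X f := by
  intro u hu huX
  refine ⟨0, 1, 1, fun j => ∑ i, MvPolynomial.C (A (Pi.single i 1) j) * MvPolynomial.X i,
    MvPolynomial.isHomogeneous_one _ _,
    fun j => MvPolynomial.IsHomogeneous.sum _ _ _ fun i _ => MvPolynomial.isHomogeneous_C_mul_X _ _,
    by simp, fun v hv hvX _ => ?_⟩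
  have e : (fun j => MvPolynomial.eval v
      (∑ i, MvPolynomial.C (A (Pi.single i 1) j) * MvPolynomial.X i)) = A v := by
    funext j
    conv_rhs => rw [pi_eq_sum_univ' v]
    simp [mul_comm]
  simp only [e, hf]
  exact ⟨fun h => hv (hA (by rw [h, map_zero])), rfl⟩

theorem exists_aut_of_matrix {d : ℕ} (hd : 2 ≤ d) {g h : Matrix (Fin 2) (Fin 2) ℂ}
    (hgh : g * h = 1) :
    ∃ (A : (Fin (d + 1) → ℂ) ≃ₗ[ℂ] (Fin (d + 1) → ℂ)) (φ : Aut (secantVariety d)),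
      (∀ p, A (veroneseVec d p) = veroneseVec d (g.mulVec p)) ∧
      (∀ u, IsTangentVec d (A u) ↔ IsTangentVec d u) ∧
      (∀ u, IsSecantVec d (A u) ↔ IsSecantVec d u) ∧
      ∀ z, (φ.1 z : ℙ ℂ (Fin (d + 1) → ℂ)) = Projectivization.map A.toLinearMap A.injective z := by
  obtain ⟨A, hA, hA'⟩ := exists_linearEquiv_veroneseVec d g h hgh
  have hhg : h * g = 1 := mul_eq_one_comm.1 hgh
  have hT : ∀ u, IsTangentVec d (A u) ↔ IsTangentVec d u := fun u =>
    ⟨fun hu => by simpa using hu.map (A := A.symm.toLinearMap) hgh hA',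
      fun hu => hu.map (A := A.toLinearMap) hhg hA⟩
  have hS : ∀ u, IsSecantVec d (A u) ↔ IsSecantVec d u := fun u =>
    ⟨fun hu => by simpa using hu.map (A := A.symm.toLinearMap) hgh hA',
      fun hu => hu.map (A := A.toLinearMap) hhg hA⟩
  have hmem : ∀ z, Projectivization.map A.toLinearMap A.injective z ∈ secantVariety d ↔
      z ∈ secantVariety d := by
    intro z
    induction z using Projectivization.ind with
    | h u hu =>
      rw [Projectivization.map_mk, mk_mem_secantVariety_iff hd, mk_mem_secantVariety_iff hd]
      exact or_congr (hT u) (hS u)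
  have hinv : ∀ z, Projectivization.map A.toLinearMap A.injective
      (Projectivization.map A.symm.toLinearMap A.symm.injective z) = z := by
    intro z
    induction z using Projectivization.ind with
    | h u hu => simp only [Projectivization.map_mk]; congr 1; simp
  have hinv' : ∀ z, Projectivization.map A.symm.toLinearMap A.symm.injective
      (Projectivization.map A.toLinearMap A.injective z) = z := by
    intro z
    induction z using Projectivization.ind with
    | h u hu => simp only [Projectivization.map_mk]; congr 1; simp
  let φ : Equiv.Perm (secantVariety d) :=
    { toFun := fun z => ⟨_, (hmem z).2 z.2⟩
      invFun := fun z => ⟨Projectivization.map A.symm.toLinearMap A.symm.injective z,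
        (hmem _).1 (by rw [hinv]; exact z.2)⟩
      left_inv := fun z => Subtype.ext (hinv' z)
      right_inv := fun z => Subtype.ext (hinv z) }
  exact ⟨A, ⟨φ, isRegularMap_of_linearMap A.toLinearMap A.injective fun z => rfl,
    isRegularMap_of_linearMap A.symm.toLinearMap A.symm.injective fun z => rfl⟩, hA, hT, hS,
    fun z => rfl⟩

/-! ### Standard vectors -/

theorem veroneseVec_one_zero (d : ℕ) : veroneseVec d ![1, 0] = Pi.single 0 1 := by
  funext k
  rcases eq_or_ne k 0 with rfl | hk
  · simp [veroneseVec]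
  · have : (k : ℕ) ≠ 0 := Fin.val_ne_zero_iff.2 hk
    simp [veroneseVec, hk, this]

theorem veroneseVec_zero_one (d : ℕ) : veroneseVec d ![0, 1] = Pi.single (Fin.last d) 1 := by
  funext k
  have : d - (k : ℕ) = 0 ↔ (k : ℕ) = d := by omega
  simp [veroneseVec, Pi.single_apply, Fin.ext_iff, zero_pow_eq, this]

theorem tangentVec_one_zero {d : ℕ} (hd : d ≠ 0) :
    tangentVec d ![1, 0] ![0, 1] = Pi.single ⟨1, by omega⟩ 1 := by
  funext ⟨k, hk⟩
  rcases (by omega : k = 0 ∨ k = 1 ∨ 2 ≤ k) with rfl | rfl | h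
  · simp [tangentVec]
  · simp [tangentVec]
  · have h1 : k - 1 ≠ 0 := by omega
    have h2 : k ≠ 1 := by omega
    simp [tangentVec, h1, h2]

/-- The first and last coordinates force `p 0` and `p 1` to be nonzero. Coordinates 1 and 2, which
vanish since `d ≥ 3`, then give a linear system forcing `w 0 = 0`, against coordinate 0. -/
theorem not_isTangentVec_standard {d : ℕ} (hd : 3 ≤ d) :
    ¬ IsTangentVec d (veroneseVec d ![1, 0] + veroneseVec d ![0, 1]) := by
  rintro ⟨p, hp, w, h⟩
  rw [veroneseVec_one_zero, veroneseVec_zero_one] at h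
  obtain ⟨n, rfl⟩ : ∃ n, d = n + 3 := ⟨d - 3, by omega⟩
  have h0 := congrFun h 0
  have h1 := congrFun h ⟨1, by omega⟩
  have h2 := congrFun h ⟨2, by omega⟩
  have hl := congrFun h (Fin.last _)
  have e1 : n + 3 - 1 - 1 = n + 1 := by omega
  have e2 : n + 3 - 1 = n + 2 := by omega
  have e3 : n + 3 - 2 = n + 1 := by omega
  simp [tangentVec, Fin.ext_iff, e2, e3] at h0 h1 h2 hl
  have hp0 : p 0 ≠ 0 := by
    intro h
    simp [h] at h0
  have hp1 : p 1 ≠ 0 := by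
    intro h
    simp [h] at hl
  have h1' : p 0 ^ (n + 1) * ((n + 2) * p 1 * w 0 + p 0 * w 1) = 0 := by
    linear_combination -h1
  have h2' : p 0 ^ n * p 1 * ((n + 1) * p 1 * w 0 + 2 * (p 0 * w 1)) = 0 := by
    linear_combination -h2
  have h1'' := (mul_eq_zero.1 h1').resolve_left (pow_ne_zero _ hp0)
  have h2'' := (mul_eq_zero.1 h2').resolve_left (mul_ne_zero (pow_ne_zero _ hp0) hp1)
  have h3 : ((n + 3 : ℕ) : ℂ) * (p 1 * w 0) = 0 := by
    push_cast
    linear_combination 2 * h1'' - h2''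
  have h4 : w 0 = 0 := by
    rcases mul_eq_zero.1 h3 with h | h
    · exact absurd h (Nat.cast_ne_zero.2 (by omega))
    · exact (mul_eq_zero.1 h).resolve_left hp1
  simp [h4] at h0

theorem IsSecantVec.not_isTangentVec {d : ℕ} (hd : 3 ≤ d) {u : Fin (d + 1) → ℂ}
    (hu : IsSecantVec d u) : ¬ IsTangentVec d u := by
  obtain ⟨p, q, hpq, rfl⟩ := hu
  obtain ⟨g, h, hgh, hp, hq⟩ := exists_matrix_pair hpq
  obtain ⟨A, -, hA, hT, -⟩ := exists_aut_of_matrix (by omega : 2 ≤ d) hgh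
  rw [← hT, map_add, hA, hA, hp, hq]
  exact not_isTangentVec_standard hd

/-! ### Points at which the Zariski tangent space is the whole ambient space -/

/-- Every homogeneous equation of `X` has vanishing differential at `u`. -/
def IsTangentSpaceTop {ι : Type*} [Fintype ι] (X : Set (ℙ ℂ (ι → ℂ))) (u : ι → ℂ) : Prop :=
  ∀ (n : ℕ) (P : MvPolynomial ι ℂ), P.IsHomogeneous n →
    (∀ (v : ι → ℂ) (hv : v ≠ 0), Projectivization.mk ℂ v hv ∈ X → MvPolynomial.eval v P = 0) →
      fderiv ℂ (fun v => MvPolynomial.eval v P) u = 0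

theorem hasDerivAt_eval_line {ι : Type*} [Fintype ι] (P : MvPolynomial ι ℂ) (u w : ι → ℂ) :
    HasDerivAt (fun t : ℂ => MvPolynomial.eval (u + t • w) P)
      (fderiv ℂ (fun v => MvPolynomial.eval v P) u w) 0 := by
  have h1 : HasFDerivAt (fun v => MvPolynomial.eval v P)
      (fderiv ℂ (fun v => MvPolynomial.eval v P) u) (u + (0 : ℂ) • w) := by
    simpa using (differentiable_eval P u).hasFDerivAt
  have h2 : HasDerivAt (fun t : ℂ => u + t • w) ((1 : ℂ) • w) 0 :=
    ((hasDerivAt_id (0 : ℂ)).smul_const w).const_add u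
  have h3 := h1.comp_hasDerivAt 0 h2
  rwa [one_smul] at h3

/-- Euler's identity for homogeneous polynomials. -/
theorem fderiv_eval_self {ι : Type*} [Fintype ι] {P : MvPolynomial ι ℂ} {n : ℕ}
    (hP : P.IsHomogeneous n) (u : ι → ℂ) :
    fderiv ℂ (fun v => MvPolynomial.eval v P) u u = n * MvPolynomial.eval u P := by
  refine (hasDerivAt_eval_line P u u).unique ?_
  have h : (fun t : ℂ => MvPolynomial.eval (u + t • u) P) =
      fun t => (1 + t) ^ n * MvPolynomial.eval u P := by
    funext t
    rw [← eval_smul_of_isHomogeneous hP, add_smul, one_smul]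
  rw [h]
  have h1 : HasDerivAt (fun t : ℂ => (1 + t)) 1 0 := (hasDerivAt_id (0 : ℂ)).const_add 1
  simpa using (h1.pow n).mul_const (MvPolynomial.eval u P)

/-- Rank-nullity modulo u': the kernel has dimension at most one, so the induced map onto the
quotient by the line of u' is surjective. -/
theorem range_sup_span_eq_top {V : Type*} [AddCommGroup V] [Module ℂ V] [FiniteDimensional ℂ V]
    (L : V →ₗ[ℂ] V) {u u' : V} (hu' : u' ≠ 0)
    (h : ∀ w, L w ∈ Submodule.span ℂ {u'} → w ∈ Submodule.span ℂ {u}) (x : V) :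
    ∃ (w : V) (c : ℂ), x = L w + c • u' := by
  set K := Submodule.span ℂ {u'}
  have hker : LinearMap.ker (K.mkQ ∘ₗ L) ≤ Submodule.span ℂ {u} := by
    intro w hw
    refine h w ?_
    rwa [LinearMap.mem_ker, LinearMap.comp_apply, Submodule.mkQ_apply,
      Submodule.Quotient.mk_eq_zero] at hw
  have h1 := Submodule.finrank_mono hker
  have h2 := finrank_span_le_card (R := ℂ) ({u} : Set V)
  rw [Set.toFinset_singleton, Finset.card_singleton] at h2
  have h3 := LinearMap.finrank_range_add_finrank_ker (K.mkQ ∘ₗ L)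
  have h4 := K.finrank_quotient_add_finrank
  have h5 : Module.finrank ℂ K = 1 := finrank_span_singleton hu'
  have h6 : LinearMap.range (K.mkQ ∘ₗ L) = ⊤ :=
    Submodule.eq_top_of_finrank_eq (le_antisymm (Submodule.finrank_le _) (by omega))
  obtain ⟨w, hw⟩ := LinearMap.range_eq_top.1 h6 (K.mkQ x)
  rw [LinearMap.comp_apply, Submodule.mkQ_apply, Submodule.mkQ_apply, Submodule.Quotient.eq,
    Submodule.mem_span_singleton] at hw
  obtain ⟨c, hc⟩ := hw
  exact ⟨w, -c, by rw [neg_smul, hc]; abel⟩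

theorem eval_aeval_eq {ι κ : Type*} (F : κ → MvPolynomial ι ℂ) (v : ι → ℂ) (P : MvPolynomial κ ℂ) :
    MvPolynomial.eval v (MvPolynomial.aeval F P) =
      MvPolynomial.eval (fun j => MvPolynomial.eval v (F j)) P := by
  induction P using MvPolynomial.induction_on with
  | C a => simp
  | add p q hp hq => simp only [map_add, hp, hq]
  | mul_X p i hp => simp only [map_mul, hp, MvPolynomial.aeval_X, MvPolynomial.eval_X]

theorem IsTangentSpaceTop.smul {ι : Type*} [Fintype ι] {X : Set (ℙ ℂ (ι → ℂ))} {u : ι → ℂ}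
    (hu : IsTangentSpaceTop X u) {a : ℂ} (ha : a ≠ 0) : IsTangentSpaceTop X (a • u) := by
  intro n P hP hPX
  ext w
  have h1 := (hasDerivAt_eval_line P u (a⁻¹ • w)).const_mul (a ^ n)
  rw [hu n P hP hPX, zero_apply, mul_zero] at h1
  have h2 := hasDerivAt_eval_line P (a • u) w
  have h3 : (fun t : ℂ => MvPolynomial.eval (a • u + t • w) P) =
      fun t => a ^ n * MvPolynomial.eval (u + t • a⁻¹ • w) P := by
    funext t
    rw [← eval_smul_of_isHomogeneous hP, smul_add, smul_comm a t, smul_inv_smul₀ ha]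
  rw [h3] at h2
  exact h2.unique h1

/-- Having full Zariski tangent space is preserved by automorphisms. -/
theorem IsTangentSpaceTop.map {ι : Type*} [Fintype ι] {X : Set (ℙ ℂ (ι → ℂ))} {φ : Equiv.Perm X}
    (hφ : φ ∈ Aut X) {u u' : ι → ℂ} (hu : u ≠ 0) (huX : Projectivization.mk ℂ u hu ∈ X)
    (hu' : u' ≠ 0) (h : (φ ⟨_, huX⟩ : ℙ ℂ (ι → ℂ)) = Projectivization.mk ℂ u' hu')
    (hsing : IsTangentSpaceTop X u) : IsTangentSpaceTop X u' := by
  obtain ⟨m, e, G, F, hG, hF, hGu, H⟩ := hφ.1 u hu huX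
  obtain ⟨hFu, hFu'⟩ := H u hu huX hGu
  rw [h] at hFu'
  obtain ⟨a, rfl⟩ := (Projectivization.mk_eq_mk_iff ℂ _ _ _ _).1 hFu'
  refine IsTangentSpaceTop.smul ?_ a.ne_zero
  clear hFu' h hu'
  obtain ⟨_, hφu⟩ := H u hu huX hGu
  have hu'X : Projectivization.mk ℂ _ hFu ∈ X := hφu ▸ (φ _).2
  have hφu' : φ ⟨_, huX⟩ = ⟨_, hu'X⟩ := Subtype.ext hφu
  obtain ⟨m', e', G', F', hG', hF', hGu', H'⟩ := hφ.2 _ hFu hu'X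
  set f : (ι → ℂ) → ι → ℂ := fun v j => MvPolynomial.eval v (F j) with hf
  have hfu : HasFDerivAt f (fderiv ℂ f u) u :=
    (differentiable_pi.2 fun j => differentiable_eval (F j)).differentiableAt.hasFDerivAt
  set L := fderiv ℂ f u
  have hcomp : ∀ P : MvPolynomial ι ℂ, HasFDerivAt (fun v => MvPolynomial.eval (f v) P)
      ((fderiv ℂ (fun v => MvPolynomial.eval v P) (f u)).comp L) u := fun P =>
    (differentiable_eval P (f u)).hasFDerivAt.comp u hfu
  have hback : ∃ c : ℂ, c ≠ 0 ∧ ∀ j, MvPolynomial.eval (f u) (F' j) = c * u j := by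
    obtain ⟨hF'u, hF'u'⟩ := H' _ hFu hu'X hGu'
    have h2 : (φ.symm ⟨_, hu'X⟩) = ⟨_, huX⟩ := by rw [← hφu', Equiv.symm_apply_apply]
    rw [h2] at hF'u'
    obtain ⟨c, hc⟩ := (Projectivization.mk_eq_mk_iff ℂ _ _ _ _).1 hF'u'
    refine ⟨c⁻¹, by simp, fun j => ?_⟩
    have hcj : (c : ℂ) * MvPolynomial.eval (f u) (F' j) = u j := congrFun hc j
    rw [← hcj, inv_mul_cancel_left₀ c.ne_zero]
  obtain ⟨c, hc0, hc⟩ := hback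
  -- Infinitesimal injectivity of φ: modulo the radial directions, the differential of the local
  -- lift has no kernel.
  have hker : ∀ w, L w ∈ Submodule.span ℂ {f u} → w ∈ Submodule.span ℂ {u} := by
    intro w hw
    obtain ⟨b, hb⟩ := Submodule.mem_span_singleton.1 hw
    have key : ∀ i j, w i * u j = w j * u i := by
      intro i j
      -- φ⁻¹ ∘ φ = id says that F'(F(v)) is proportional to v on X. The factor built from `G` and
      -- `G'` makes this 2 × 2 minor vanish also outside the charts, so it is an equation of X.
      let Q : MvPolynomial ι ℂ := (G * MvPolynomial.aeval F G') *
        (MvPolynomial.X i * MvPolynomial.aeval F (F' j) -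
          MvPolynomial.X j * MvPolynomial.aeval F (F' i))
      have hQ : Q.IsHomogeneous ((m + e * m') + (1 + e * e')) :=
        (hG.mul (hG'.aeval F hF)).mul
          (((MvPolynomial.isHomogeneous_X _ i).mul ((hF' j).aeval F hF)).sub
            ((MvPolynomial.isHomogeneous_X _ j).mul ((hF' i).aeval F hF)))
      have hQe : ∀ v, MvPolynomial.eval v Q = (MvPolynomial.eval v G * MvPolynomial.eval (f v) G') *
          (v i * MvPolynomial.eval (f v) (F' j) - v j * MvPolynomial.eval (f v) (F' i)) := by
        intro v
        simp only [Q, map_mul, map_sub, eval_aeval_eq, MvPolynomial.eval_X, hf]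
      have hQX : ∀ (v : ι → ℂ) (hv : v ≠ 0), Projectivization.mk ℂ v hv ∈ X →
          MvPolynomial.eval v Q = 0 := by
        intro v hv hvX
        rw [hQe]
        by_cases h1 : MvPolynomial.eval v G = 0
        · rw [h1, zero_mul, zero_mul]
        by_cases h2 : MvPolynomial.eval (f v) G' = 0
        · rw [h2, mul_zero, zero_mul]
        obtain ⟨hfv, hfv'⟩ := H v hv hvX h1
        have hfvX : Projectivization.mk ℂ _ hfv ∈ X := hfv' ▸ (φ _).2
        obtain ⟨hgv, hgv'⟩ := H' _ hfv hfvX h2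
        have h3 : φ.symm ⟨_, hfvX⟩ = ⟨_, hvX⟩ := by
          rw [Equiv.symm_apply_eq]
          exact Subtype.ext hfv'.symm
        rw [h3] at hgv'
        obtain ⟨b, hb⟩ := (Projectivization.mk_eq_mk_iff' ℂ _ _ _ _).1 hgv'
        have h4 := congrFun hb
        simp only [Pi.smul_apply, smul_eq_mul] at h4
        rw [← h4 i, ← h4 j]
        ring
      have hd0 := hsing _ Q hQ hQX
      have hi : HasFDerivAt (fun v : ι → ℂ => v i) (ContinuousLinearMap.proj (R := ℂ) i) u :=
        (ContinuousLinearMap.proj (R := ℂ) (φ := fun _ : ι => ℂ) i).hasFDerivAt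
      have hj : HasFDerivAt (fun v : ι → ℂ => v j) (ContinuousLinearMap.proj (R := ℂ) j) u :=
        (ContinuousLinearMap.proj (R := ℂ) (φ := fun _ : ι => ℂ) j).hasFDerivAt
      have hd1 := ((differentiable_eval G u).hasFDerivAt.mul (hcomp G')).mul
        ((hi.mul (hcomp (F' j))).sub (hj.mul (hcomp (F' i))))
      have hd2 := (hd1.congr_of_eventuallyEq (.of_forall hQe)).fderiv
      rw [hd0] at hd2
      have hd3 := DFunLike.congr_fun hd2 w
      -- As L w is radial, Euler turns the derivatives of `F'` into multiples of the coordinates of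
      -- u, and these contributions cancel.
      simp [← hb, hc, fderiv_eval_self (hF' _)] at hd3
      have h5 : MvPolynomial.eval u G * MvPolynomial.eval (f u) G' *
          (c * (w i * u j - w j * u i)) = 0 := by
        linear_combination -hd3
      have h6 := (mul_eq_zero.1 h5).resolve_left (mul_ne_zero hGu hGu')
      refine mul_left_cancel₀ hc0 ?_
      linear_combination h6
    obtain ⟨j, hj⟩ := Function.ne_iff.1 hu
    refine Submodule.mem_span_singleton.2 ⟨w j / u j, funext fun i => ?_⟩
    have hj : u j ≠ 0 := hj
    simp only [Pi.smul_apply, smul_eq_mul]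
    field_simp
    linear_combination -key i j
  intro n P hP hPX
  have hPu : MvPolynomial.eval (f u) P = 0 := hPX _ hFu hu'X
  -- The pullback of P, multiplied by `G`, is an equation of X, so its differential at u vanishes.
  have hL : ∀ w, fderiv ℂ (fun v => MvPolynomial.eval v P) (f u) (L w) = 0 := by
    intro w
    have hQ : (G * MvPolynomial.aeval F P).IsHomogeneous (m + e * n) := hG.mul (hP.aeval F hF)
    have hd0 := hsing _ _ hQ fun v hv hvX => by
      rw [map_mul, eval_aeval_eq]
      by_cases h1 : MvPolynomial.eval v G = 0
      · rw [h1, zero_mul]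
      obtain ⟨hfv, hfv'⟩ := H v hv hvX h1
      rw [hPX _ hfv (hfv' ▸ (φ _).2), mul_zero]
    have hd1 := (differentiable_eval G u).hasFDerivAt.mul (hcomp P)
    have hd2 := (hd1.congr_of_eventuallyEq (.of_forall fun v => by
      show MvPolynomial.eval v (G * MvPolynomial.aeval F P) = _
      rw [map_mul, eval_aeval_eq]
      rfl)).fderiv
    rw [hd0] at hd2
    have hd3 := DFunLike.congr_fun hd2 w
    simp [hPu, hGu] at hd3
    exact hd3
  ext x
  obtain ⟨w, b, rfl⟩ := range_sup_span_eq_top L.toLinearMap hFu hker x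
  rw [map_add, map_smul, fderiv_eval_self hP, hPu, mul_zero, smul_zero, add_zero]
  exact hL w

/-! ### The curve is the singular locus of the secant variety -/

/-- Each line joining v(p) to another v(q) lies in the secant variety, so every equation has zero
derivative along v(q); these vectors span. -/
theorem isTangentSpaceTop_veroneseVec {d : ℕ} (hd : 2 ≤ d) {p : Fin 2 → ℂ} (hp : p ≠ 0) :
    IsTangentSpaceTop (secantVariety d) (veroneseVec d p) := by
  have hd0 : d ≠ 0 := by omega
  intro n P hP hPX
  have hPp : MvPolynomial.eval (veroneseVec d p) P = 0 := by
    refine hPX _ (veroneseVec_ne_zero d hp) ((mk_mem_secantVariety_iff hd _).2 (.inl ?_))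
    simpa using isTangentVec_smul_veroneseVec hd0 hp 1
  refine ContinuousLinearMap.coe_injective ?_
  refine LinearMap.ext_on_range (v := veroneseVec d) (span_veroneseVec d) fun q => ?_
  show fderiv ℂ (fun v => MvPolynomial.eval v P) (veroneseVec d p) (veroneseVec d q) = 0
  by_cases hpq : p 0 * q 1 - p 1 * q 0 = 0
  · obtain ⟨c, rfl⟩ := exists_smul_of_pair_det_eq_zero hp hpq
    rw [veroneseVec_smul, map_smul, fderiv_eval_self hP, hPp, mul_zero, smul_zero]
  · refine (hasDerivAt_eval_line P _ _).unique ?_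
    have : (fun t : ℂ => MvPolynomial.eval (veroneseVec d p + t • veroneseVec d q) P) =
        fun _ => 0 := by
      funext t
      have h := isTangentVec_or_isSecantVec hd0 hpq 1 t
      rw [one_smul] at h
      refine hPX _ (fun h0 => hpq ?_) ((mk_mem_secantVariety_iff hd _).2 h)
      refine pair_det_eq_zero_of_veroneseVec_eq_smul hd0 (a := -t) ?_
      rw [neg_smul]
      exact eq_neg_of_add_eq_zero_left h0
    rw [this]
    exact hasDerivAt_const _ _

theorem hasDerivAt_det_hankel {d : ℕ} {u : Fin (d + 1) → ℂ}
    (h : IsTangentSpaceTop (secantVariety d) u) (r : Fin 3 → Fin (d - 1)) (w : Fin (d + 1) → ℂ) :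
    HasDerivAt (fun t : ℂ => ((hankel d (u + t • w)).submatrix r id).det) 0 0 := by
  have h1 := hasDerivAt_eval_line (hankelMinor d r) u w
  rw [h 3 _ (isHomogeneous_hankelMinor d r) fun v hv hvX => eval_hankelMinor_of_mk_mem hv hvX r] at h1
  simpa only [eval_hankelMinor, zero_apply] using h1

theorem not_isTangentSpaceTop_tangent {d : ℕ} (hd : 4 ≤ d) :
    ¬ IsTangentSpaceTop (secantVariety d) (tangentVec d ![1, 0] ![0, 1]) := by
  intro h
  rw [tangentVec_one_zero (by omega)] at h
  have h1 := hasDerivAt_det_hankel h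
    -- At e₁ + t e₄ this minor equals −t; coordinate 4 exists because `d ≥ 4`.
    ![⟨0, by omega⟩, ⟨1, by omega⟩, ⟨2, by omega⟩] (Pi.single ⟨4, by omega⟩ 1)
  have h2 : HasDerivAt (fun t : ℂ => -t) (-1) 0 := (hasDerivAt_id (0 : ℂ)).neg
  have h3 := h1.unique (h2.congr_of_eventuallyEq (.of_forall fun t => ?_))
  · simp at h3
  · beta_reduce
    rw [Matrix.det_fin_three]
    simp [hankel, Pi.single_apply]

theorem not_isTangentSpaceTop_standard {d : ℕ} (hd : 4 ≤ d) :
    ¬ IsTangentSpaceTop (secantVariety d) (veroneseVec d ![1, 0] + veroneseVec d ![0, 1]) := by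
  intro h
  rw [veroneseVec_one_zero, veroneseVec_zero_one] at h
  have h1 := hasDerivAt_det_hankel h
    ![⟨0, by omega⟩, ⟨1, by omega⟩, ⟨d - 2, by omega⟩] (Pi.single ⟨2, by omega⟩ 1)
  -- The minor at e₀ + e_d + t e₂. The cubic term appears for `d = 4`, when row `d - 2` starts with
  -- coordinate 2.
  have h2 : HasDerivAt (fun t : ℂ => t - t ^ 3 * if d = 4 then 1 else 0) 1 0 := by
    exact ((hasDerivAt_id' (0 : ℂ)).fun_sub (((hasDerivAt_id' (0 : ℂ)).fun_pow 3).mul_const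
      (if d = 4 then (1 : ℂ) else 0))).congr_deriv (by simp)
  have h3 := h1.unique (h2.congr_of_eventuallyEq (.of_forall fun t => ?_))
  · simp at h3
  · beta_reduce
    set x : Fin (d + 1) → ℂ := Pi.single 0 1 + Pi.single (Fin.last d) 1 + t • Pi.single ⟨2, by omega⟩ 1
    have hx : ∀ (k : ℕ) (hk : k < d + 1), x ⟨k, hk⟩ =
        (if k = 0 then 1 else 0) + (if k = d then 1 else 0) + t * (if k = 2 then 1 else 0) := by
      intro k hk
      simp [x, Pi.single_apply, Fin.ext_iff]
    have hx0 : x ⟨0, by omega⟩ = 1 := by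
      rw [hx, if_pos rfl, if_neg (by omega), if_neg (by omega)]; simp
    have hx1 : x ⟨1, by omega⟩ = 0 := by
      rw [hx, if_neg (by omega), if_neg (by omega), if_neg (by omega)]; simp
    have hx2 : x ⟨2, by omega⟩ = t := by
      rw [hx, if_neg (by omega), if_neg (by omega), if_pos rfl]; simp
    have hx3 : x ⟨3, by omega⟩ = 0 := by
      rw [hx, if_neg (by omega), if_neg (by omega), if_neg (by omega)]; simp
    have hx4 : x ⟨d - 2, by omega⟩ = if d = 4 then t else 0 := by
      rw [hx, if_neg (by omega), if_neg (by omega)]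
      simp [show d - 2 = 2 ↔ d = 4 by omega]
    have hx5 : x ⟨d - 2 + 1, by omega⟩ = 0 := by
      rw [hx, if_neg (by omega), if_neg (by omega), if_neg (by omega)]; simp
    have hx6 : x ⟨d - 2 + 2, by omega⟩ = 1 := by
      rw [hx, if_neg (by omega), if_pos (by omega), if_neg (by omega)]; simp
    rw [Matrix.det_fin_three]
    simp only [hankel, Matrix.submatrix_apply, Matrix.of_apply, id, Matrix.cons_val, Fin.val_zero,
      Fin.val_one, Fin.val_two, Nat.zero_add, Nat.add_zero, Nat.reduceAdd, hx0, hx1, hx2, hx3, hx4,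
      hx5, hx6]
    split_ifs <;> ring

/-- Automorphisms of the secant variety preserve the curve. -/
theorem aut_mem_rationalNormalCurve {d : ℕ} (hd : 4 ≤ d) {φ : Equiv.Perm (secantVariety d)}
    (hφ : φ ∈ Aut (secantVariety d)) {z : secantVariety d}
    (hz : (z : ℙ ℂ (Fin (d + 1) → ℂ)) ∈ rationalNormalCurve d) :
    (φ z : ℙ ℂ (Fin (d + 1) → ℂ)) ∈ rationalNormalCurve d := by
  have hd0 : d ≠ 0 := by omega
  have hd2 : 2 ≤ d := by omega
  obtain ⟨z, hzS⟩ := z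
  obtain ⟨p, hp, rfl⟩ := hz
  obtain ⟨u, hu, hφu⟩ : ∃ u hu, (φ ⟨_, hzS⟩ : ℙ ℂ (Fin (d + 1) → ℂ)) = Projectivization.mk ℂ u hu :=
    ⟨_, Projectivization.rep_nonzero _, (Projectivization.mk_rep _).symm⟩
  have hsing := (isTangentSpaceTop_veroneseVec hd2 hp).map hφ _ hzS hu hφu
  have huS : Projectivization.mk ℂ u hu ∈ secantVariety d := hφu ▸ (φ _).2
  rw [hφu, mk_mem_rationalNormalCurve_iff hd0]
  rcases (mk_mem_secantVariety_iff hd2 hu).1 huS with ⟨p, hp, w, rfl⟩ | ⟨p, q, hpq, rfl⟩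
  · by_cases hpw : p 0 * w 1 - p 1 * w 0 = 0
    · obtain ⟨c, rfl⟩ := exists_smul_of_pair_det_eq_zero hp hpw
      obtain ⟨b, hb, -⟩ := exists_veroneseVec_eq_smul hd0 (c * d) p
      exact ⟨b • p, by rw [← hb, tangentVec_smul, tangentVec_self, smul_smul]⟩
    · exfalso
      obtain ⟨g, h, hgh, hgp, hgw⟩ := exists_matrix_pair hpw
      obtain ⟨A, ψ, hA, -, -, hψ⟩ := exists_aut_of_matrix hd2 hgh
      have hAu : A (tangentVec d p w) = tangentVec d ![1, 0] ![0, 1] := by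
        have := map_tangentVec (A := A.toLinearMap) hA p w
        rwa [hgp, hgw] at this
      refine not_isTangentSpaceTop_tangent hd ?_
      rw [← hAu]
      exact hsing.map ψ.2 hu huS (A.map_ne_zero_iff.2 hu) (hψ _)
  · exfalso
    obtain ⟨g, h, hgh, hgp, hgw⟩ := exists_matrix_pair hpq
    obtain ⟨A, ψ, hA, -, -, hψ⟩ := exists_aut_of_matrix hd2 hgh
    have hAu : A (veroneseVec d p + veroneseVec d q) = veroneseVec d ![1, 0] + veroneseVec d ![0, 1] := by
      rw [map_add, hA, hA, hgp, hgw]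
    refine not_isTangentSpaceTop_standard hd ?_
    rw [← hAu]
    exact hsing.map ψ.2 hu huS (A.map_ne_zero_iff.2 hu) (hψ _)

/-! ### Lifting rational maps to coprime tuples of polynomials -/

/-- Divide out the gcd. If F has gcd 1 and G' is proportional to it, taking gcds over i in F_i G'_j
= F_j G'_i shows that F_j divides G'_j. -/
theorem exists_primitive_tuple {R κ : Type*} [CommRing R] [IsDomain R]
    [UniqueFactorizationMonoid R] [Fintype κ] {G : κ → R} (hG : ∃ j, G j ≠ 0) :
    ∃ (h : R) (F : κ → R), (∀ j, G j = h * F j) ∧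
      ∀ G' : κ → R, (∀ i j, F i * G' j = F j * G' i) → ∃ h' : R, ∀ j, G' j = h' * F j := by
  classical
  let : StrongNormalizationMonoid R := UniqueFactorizationMonoid.strongNormalizationMonoid
  let : StrongNormalizedGCDMonoid R := UniqueFactorizationMonoid.toStrongNormalizedGCDMonoid R
  obtain ⟨j₀, hj₀⟩ := hG
  obtain ⟨F, hF, hF1⟩ := Finset.extract_gcd G ⟨j₀, Finset.mem_univ j₀⟩
  refine ⟨_, F, fun j => hF j (Finset.mem_univ j), fun G' hG' => ?_⟩
  have hdvd : ∀ j, F j ∣ G' j := by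
    intro j
    have h1 : Finset.univ.gcd (fun i => G' j * F i) = normalize (G' j) := by
      rw [Finset.gcd_mul_left, hF1, mul_one]
    have h2 : Finset.univ.gcd (fun i => F j * G' i) = normalize (F j) * Finset.univ.gcd G' :=
      Finset.gcd_mul_left
    have h3 : (fun i => G' j * F i) = fun i => F j * G' i := by
      funext i
      rw [mul_comm, hG']
    rw [h3, h2] at h1
    have h4 : normalize (F j) ∣ normalize (G' j) := ⟨_, h1.symm⟩
    rwa [normalize_dvd_iff, dvd_normalize_iff] at h4
  have hFj₀ : F j₀ ≠ 0 := by
    intro h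
    exact hj₀ (by rw [hF j₀ (Finset.mem_univ j₀), h, mul_zero])
  obtain ⟨h', hh'⟩ := hdvd j₀
  refine ⟨h', fun j => mul_left_cancel₀ hFj₀ ?_⟩
  rw [hG', hh']
  ring

/-! ### Weighted gradings on polynomial rings. -/

section WeightedHomogeneous

variable {σ : Type*} (w : σ → ℕ)

/-- The coaction of the multiplicative group defining the weighted grading. -/
def weightCoaction : MvPolynomial σ ℂ →ₐ[ℂ] Polynomial (MvPolynomial σ ℂ) :=
  MvPolynomial.aeval fun i => Polynomial.C (MvPolynomial.X i) * Polynomial.X ^ w i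

theorem weightCoaction_monomial (s : σ →₀ ℕ) (c : ℂ) :
    weightCoaction w (MvPolynomial.monomial s c) =
      Polynomial.C (MvPolynomial.monomial s c) * Polynomial.X ^ Finsupp.weight w s := by
  rw [weightCoaction, MvPolynomial.aeval_monomial, MvPolynomial.monomial_eq, Finsupp.weight_apply,
    Finsupp.prod, Finsupp.prod, Finsupp.sum]
  simp only [mul_pow, Finset.prod_mul_distrib, ← pow_mul, Finset.prod_pow_eq_pow_sum, map_mul,
    map_prod, map_pow, smul_eq_mul, mul_comm (w _), mul_assoc]
  rfl

theorem coeff_coeff_weightCoaction (F : MvPolynomial σ ℂ) (s : σ →₀ ℕ) :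
    MvPolynomial.coeff s ((weightCoaction w F).coeff (Finsupp.weight w s)) =
      MvPolynomial.coeff s F := by
  classical
  induction F using MvPolynomial.induction_on' with
  | monomial t c =>
    rw [weightCoaction_monomial, Polynomial.coeff_C_mul_X_pow]
    split_ifs with h
    · rfl
    · rw [MvPolynomial.coeff_monomial, if_neg (fun e => h (by rw [e])), MvPolynomial.coeff_zero]
  | add p q hp hq => rw [map_add, Polynomial.coeff_add, MvPolynomial.coeff_add, hp, hq,
      MvPolynomial.coeff_add]

variable {w}

theorem weightCoaction_of_isWeightedHomogeneous {F : MvPolynomial σ ℂ} {n : ℕ}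
    (hF : F.IsWeightedHomogeneous w n) :
    weightCoaction w F = Polynomial.C F * Polynomial.X ^ n := by
  conv_lhs => rw [F.as_sum]
  conv_rhs => rw [F.as_sum]
  rw [map_sum, map_sum, Finset.sum_mul]
  refine Finset.sum_congr rfl fun s hs => ?_
  rw [weightCoaction_monomial, hF (MvPolynomial.mem_support_iff.1 hs)]

/-- A factor of a nonzero weighted homogeneous polynomial is weighted homogeneous. -/
theorem exists_isWeightedHomogeneous_of_mul {F H : MvPolynomial σ ℂ} {n : ℕ}
    (h : (F * H).IsWeightedHomogeneous w n) (h0 : F * H ≠ 0) :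
    ∃ a, F.IsWeightedHomogeneous w a := by
  have h1 := weightCoaction_of_isWeightedHomogeneous h
  rw [map_mul] at h1
  have h2 : Polynomial.C (F * H) * Polynomial.X ^ n ≠ 0 := by simpa using h0
  have hF0 : weightCoaction w F ≠ 0 := fun e => h2 (by rw [← h1, e, zero_mul])
  have hH0 : weightCoaction w H ≠ 0 := fun e => h2 (by rw [← h1, e, mul_zero])
  have h3 := congrArg Polynomial.natDegree h1
  have h4 := congrArg Polynomial.natTrailingDegree h1
  rw [Polynomial.natDegree_mul hF0 hH0, Polynomial.natDegree_C_mul_X_pow _ _ h0] at h3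
  rw [Polynomial.natTrailingDegree_mul hF0 hH0, Polynomial.C_mul_X_pow_eq_monomial,
    Polynomial.natTrailingDegree_monomial h0] at h4
  have h5 := Polynomial.natTrailingDegree_le_natDegree (weightCoaction w F)
  have h6 := Polynomial.natTrailingDegree_le_natDegree (weightCoaction w H)
  -- The image of the product is a single power of the grading variable, so lowest and highest
  -- degrees coincide for each factor.
  refine ⟨(weightCoaction w F).natDegree, fun s hs => ?_⟩
  have hc : (weightCoaction w F).coeff (Finsupp.weight w s) ≠ 0 := by
    intro e
    rw [← coeff_coeff_weightCoaction w, e, MvPolynomial.coeff_zero] at hs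
    exact hs rfl
  have h7 := Polynomial.le_natDegree_of_ne_zero hc
  have h8 := Polynomial.natTrailingDegree_le_of_ne_zero hc
  omega

theorem exists_isWeightedHomogeneous_tuple {κ : Type*} {F : κ → MvPolynomial σ ℂ}
    {H : MvPolynomial σ ℂ} {n : ℕ} (h : ∀ j, (H * F j).IsWeightedHomogeneous w n)
    (h0 : ∃ j, H * F j ≠ 0) : ∃ a, ∀ j, (F j).IsWeightedHomogeneous w a := by
  obtain ⟨j₀, hj₀⟩ := h0
  obtain ⟨b, hb⟩ := exists_isWeightedHomogeneous_of_mul (h j₀) hj₀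
  have hH : H ≠ 0 := left_ne_zero_of_mul hj₀
  refine ⟨n - b, fun j => ?_⟩
  by_cases hj : F j = 0
  · rw [hj]
    exact MvPolynomial.isWeightedHomogeneous_zero ℂ w _
  obtain ⟨a, ha⟩ := exists_isWeightedHomogeneous_of_mul (mul_comm H (F j) ▸ h j)
    (mul_ne_zero hj hH)
  have := MvPolynomial.IsWeightedHomogeneous.inj_right (mul_ne_zero hH hj) (hb.mul ha) (h j)
  rwa [show n - b = a by omega]

theorem isWeightedHomogeneous_aeval {ι : Type*} {G : MvPolynomial ι ℂ} {e n : ℕ}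
    (hG : G.IsHomogeneous e) {π : ι → MvPolynomial σ ℂ}
    (hπ : ∀ i, (π i).IsWeightedHomogeneous w n) :
    (MvPolynomial.aeval π G).IsWeightedHomogeneous w (e * n) := by
  rw [MvPolynomial.aeval_def, MvPolynomial.eval₂_eq]
  refine MvPolynomial.IsWeightedHomogeneous.sum _ _ _ fun s hs => ?_
  refine MvPolynomial.IsWeightedHomogeneous.C_mul ?_ _
  have hs' : ∑ i ∈ s.support, s i * n = e * n := by
    rw [← Finset.sum_mul]
    congr 1
    by_contra h
    exact (MvPolynomial.mem_support_iff.1 hs) (hG.coeff_eq_zero h)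
  rw [← hs']
  exact MvPolynomial.IsWeightedHomogeneous.prod _ _ _ fun i _ => by
    simpa using (hπ i).pow (s i)

end WeightedHomogeneous

/-- A regular map composed with a polynomial parametrization is given by a single tuple of weighted
homogeneous polynomials wherever the parametrization is nonzero. -/
theorem exists_polynomial_lift {ι κ σ : Type*} [Fintype κ] {X : Set (ℙ ℂ (ι → ℂ))}
    {Y : Set (ℙ ℂ (κ → ℂ))} {f : X → Y} (hf : IsRegularMap X Y f) {w : σ → ℕ} {n : ℕ}
    {π : ι → MvPolynomial σ ℂ} (hπ : ∀ i, (π i).IsWeightedHomogeneous w n)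
    (hπ0 : ∃ v, (fun i => MvPolynomial.eval v (π i)) ≠ 0)
    (hX : ∀ (v : σ → ℂ) (hv : (fun i => MvPolynomial.eval v (π i)) ≠ 0),
      Projectivization.mk ℂ _ hv ∈ X) :
    ∃ (N : ℕ) (F : κ → MvPolynomial σ ℂ), (∀ j, (F j).IsWeightedHomogeneous w N) ∧
      ∀ (v : σ → ℂ) (hv : (fun i => MvPolynomial.eval v (π i)) ≠ 0),
        ∃ h : (fun j => MvPolynomial.eval v (F j)) ≠ 0,
          (f ⟨_, hX v hv⟩ : ℙ ℂ (κ → ℂ)) = Projectivization.mk ℂ _ h := by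
  obtain ⟨v₀, hv₀⟩ := hπ0
  obtain ⟨m, e, G₀, G, hG₀, hG, hG₀v, H⟩ := hf _ hv₀ (hX v₀ hv₀)
  obtain ⟨hGv₀, -⟩ := H _ hv₀ (hX v₀ hv₀) hG₀v
  obtain ⟨j₀, hj₀⟩ := Function.ne_iff.1 hGv₀
  rw [← eval_aeval_eq] at hj₀ hG₀v
  have hj₀' : MvPolynomial.aeval π (G j₀) ≠ 0 := fun h => hj₀ (by rw [h]; exact map_zero _)
  have hG₀' : MvPolynomial.aeval π G₀ ≠ 0 := fun h => hG₀v (by rw [h]; exact map_zero _)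
  obtain ⟨i₀, hi₀⟩ := Function.ne_iff.1 hv₀
  have hi₀' : π i₀ ≠ 0 := fun h => hi₀ (by simp [h])
  obtain ⟨h, F, hF, hprim⟩ := exists_primitive_tuple
    (G := fun j => MvPolynomial.aeval π (G j)) ⟨j₀, hj₀'⟩
  have hh : h ≠ 0 := by
    rintro rfl
    exact hj₀' (by rw [hF, zero_mul])
  obtain ⟨N, hN⟩ := exists_isWeightedHomogeneous_tuple (F := F) (H := h)
    (fun j => hF j ▸ isWeightedHomogeneous_aeval (hG j) hπ) ⟨j₀, hF j₀ ▸ hj₀'⟩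
  refine ⟨N, F, hN, fun v hv => ?_⟩
  obtain ⟨m', e', G₀', G', -, hG', hG₀v', H'⟩ := hf _ hv (hX v hv)
  obtain ⟨hGv, hGv'⟩ := H' _ hv (hX v hv) hG₀v'
  rw [← eval_aeval_eq] at hG₀v'
  have hG₀'' : MvPolynomial.aeval π G₀' ≠ 0 := fun h => hG₀v' (by rw [h]; exact map_zero _)
  obtain ⟨h', hh'⟩ := hprim (fun j => MvPolynomial.aeval π (G' j)) fun i j => by
    -- These nonzero factors reduce the identity to points where both local presentations of `f`
    -- apply.
    refine mul_left_cancel₀ (mul_ne_zero hh (mul_ne_zero (mul_ne_zero hG₀' hG₀'') hi₀')) ?_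
    refine MvPolynomial.funext fun x => ?_
    simp only [map_mul]
    by_cases h1 : MvPolynomial.eval x (MvPolynomial.aeval π G₀) = 0
    · rw [h1]; ring
    by_cases h2 : MvPolynomial.eval x (MvPolynomial.aeval π G₀') = 0
    · rw [h2]; ring
    by_cases h3 : MvPolynomial.eval x (π i₀) = 0
    · rw [h3]; ring
    have hx : (fun i => MvPolynomial.eval x (π i)) ≠ 0 := fun e => h3 (congrFun e i₀)
    rw [eval_aeval_eq] at h1 h2
    obtain ⟨hy, hy'⟩ := H _ hx (hX x hx) h1
    obtain ⟨hz, hz'⟩ := H' _ hx (hX x hx) h2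
    obtain ⟨c, hc⟩ := (Projectivization.mk_eq_mk_iff' ℂ _ _ _ _).1 (hz'.symm.trans hy')
    have hc' : ∀ k, MvPolynomial.eval x (MvPolynomial.aeval π (G' k)) =
        c * (MvPolynomial.eval x h * MvPolynomial.eval x (F k)) := by
      intro k
      rw [← map_mul, ← hF, eval_aeval_eq, eval_aeval_eq]
      exact (congrFun hc k).symm
    rw [hc', hc']
    ring
  have hev : (fun j => MvPolynomial.eval (fun i => MvPolynomial.eval v (π i)) (G' j)) =
      MvPolynomial.eval v h' • fun j => MvPolynomial.eval v (F j) := by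
    funext j
    rw [← eval_aeval_eq, hh', map_mul]
    rfl
  have hFv : (fun j => MvPolynomial.eval v (F j)) ≠ 0 := fun e => hGv (by rw [hev, e, smul_zero])
  refine ⟨hFv, ?_⟩
  rw [hGv', Projectivization.mk_eq_mk_iff']
  exact ⟨_, hev.symm⟩

/-! ### Automorphisms on the cone over the curve with vertex on the curve -/

/-- The parametrization `(x, y, a) ↦ v(x, y) + a • v(1, 0)` of the cone over the curve. -/
def conePoly (d : ℕ) (k : Fin (d + 1)) : MvPolynomial (Fin 3) ℂ :=
  MvPolynomial.X 0 ^ (d - (k : ℕ)) * MvPolynomial.X 1 ^ (k : ℕ) +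
    if k = 0 then MvPolynomial.X 2 else 0

/-- Giving the coefficient of the vertex weight `d` exhibits the cone as an image of the weighted
projective plane P(1,1,d). -/
theorem isWeightedHomogeneous_conePoly (d : ℕ) (k : Fin (d + 1)) :
    (conePoly d k).IsWeightedHomogeneous ![1, 1, d] d := by
  refine .add ?_ ?_
  · have h := ((MvPolynomial.isWeightedHomogeneous_X ℂ ![1, 1, d] 0).pow (d - (k : ℕ))).mul
      ((MvPolynomial.isWeightedHomogeneous_X ℂ ![1, 1, d] 1).pow (k : ℕ))
    have e : (d - (k : ℕ)) • (![1, 1, d] : Fin 3 → ℕ) 0 + (k : ℕ) • (![1, 1, d] : Fin 3 → ℕ) 1 = d := by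
      simp only [Matrix.cons_val_zero, Matrix.cons_val_one, smul_eq_mul, mul_one]
      omega
    rwa [e] at h
  · split_ifs
    · exact MvPolynomial.isWeightedHomogeneous_X ℂ ![1, 1, d] 2
    · exact MvPolynomial.isWeightedHomogeneous_zero ℂ _ _

theorem eval_conePoly (d : ℕ) (x y a : ℂ) :
    (fun k => MvPolynomial.eval ![x, y, a] (conePoly d k)) =
      veroneseVec d ![x, y] + a • veroneseVec d ![1, 0] := by
  funext k
  rw [veroneseVec_one_zero]
  by_cases hk : k = 0
  · simp [conePoly, veroneseVec, hk]
  · simp [conePoly, veroneseVec, hk]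

theorem isTangentVec_or_isSecantVec_cone {d : ℕ} (hd : d ≠ 0) (x y a : ℂ) :
    IsTangentVec d (veroneseVec d ![x, y] + a • veroneseVec d ![1, 0]) ∨
      IsSecantVec d (veroneseVec d ![x, y] + a • veroneseVec d ![1, 0]) := by
  by_cases hy : y = 0
  · left
    have : (![x, y] : Fin 2 → ℂ) = x • ![1, 0] := by
      rw [hy]
      simp
    rw [this, veroneseVec_smul, ← add_smul]
    exact isTangentVec_smul_veroneseVec hd (by simp) _
  · have := isTangentVec_or_isSecantVec hd (p := ![x, y]) (q := ![1, 0]) (by simpa using hy) 1 a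
    rwa [one_smul] at this

/-- Setting the first variable to zero leaves only the weight-`d` monomials y^d and a. -/
theorem eval_eq_add_of_isWeightedHomogeneous {d : ℕ} (hd : d ≠ 0) {P : MvPolynomial (Fin 3) ℂ}
    (hP : P.IsWeightedHomogeneous ![1, 1, d] d) :
    MvPolynomial.eval ![0, 1, 1] P =
      MvPolynomial.eval ![0, 1, 0] P + MvPolynomial.eval ![0, 0, 1] P := by
  simp only [MvPolynomial.eval_eq']
  rw [← Finset.sum_add_distrib]
  refine Finset.sum_congr rfl fun m hm => ?_
  have h : Finsupp.weight ![1, 1, d] m = d := hP (MvPolynomial.mem_support_iff.1 hm)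
  rw [Finsupp.weight_apply, Finsupp.sum_fintype _ _ (by simp), Fin.sum_univ_three] at h
  simp only [Matrix.cons_val, smul_eq_mul, mul_one] at h
  rw [← mul_add]
  congr 1
  simp only [Fin.prod_univ_three, Matrix.cons_val, one_pow, mul_one]
  rcases Nat.eq_zero_or_pos (m 0) with h0 | h0
  · rcases Nat.eq_zero_or_pos (m 2) with h2 | h2
    · have h1 : m 1 ≠ 0 := by rw [h0, h2] at h; omega
      simp [h0, h1, h2]
    · have h1 : m 1 = 0 ∧ m 2 = 1 := by
        have : d ≤ m 2 * d := Nat.le_mul_of_pos_left d h2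
        have h3 : m 2 * d = 1 * d := by omega
        exact ⟨by omega, Nat.eq_of_mul_eq_mul_right (Nat.pos_of_ne_zero hd) h3⟩
      simp [h0, h1.1, h1.2]
  · simp [h0.ne']

/-- The polynomial `k` divides a unit times a power of the prime `X`. -/
theorem eq_C_mul_X_pow_of_pow_eq {k : Polynomial ℂ} {c : ℂ} (hc : c ≠ 0) {d N : ℕ} (hd : d ≠ 0)
    (h : k ^ d = Polynomial.C c * Polynomial.X ^ N) :
    ∃ (b : ℂ) (i : ℕ), k = Polynomial.C b * Polynomial.X ^ i ∧ N = d * i := by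
  have h1 : k ∣ Polynomial.X ^ N := by
    have h2 : k ∣ Polynomial.C c * Polynomial.X ^ N := h ▸ dvd_pow_self k hd
    rwa [(Polynomial.isUnit_C.2 (isUnit_iff_ne_zero.2 hc)).dvd_mul_left] at h2
  obtain ⟨i, -, hi⟩ := (dvd_prime_pow Polynomial.prime_X N).1 h1
  obtain ⟨u, hu⟩ := hi.symm
  obtain ⟨b, hb, hb'⟩ := Polynomial.isUnit_iff.1 u.isUnit
  refine ⟨b, i, by rw [← hu, ← hb', mul_comm], ?_⟩
  have h3 := congrArg Polynomial.natDegree h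
  rw [Polynomial.natDegree_pow, Polynomial.natDegree_C_mul_X_pow _ _ hc, ← hu, ← hb', mul_comm (_ ^ _),
    Polynomial.natDegree_C_mul_X_pow _ _ hb.ne_zero] at h3
  exact h3.symm

/-- Constants are not injective, and for `i ≥ 2` neither are powers, because of roots of unity. -/
theorem eq_one_of_injective_pow {b : ℂ} {i : ℕ}
    (h : Function.Injective fun t : ℂ => b * t ^ i) : i = 1 := by
  rcases (by omega : i = 0 ∨ i = 1 ∨ 2 ≤ i) with rfl | rfl | hi
  · exact absurd (h (a₁ := 0) (a₂ := 1) (by simp)) zero_ne_one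
  · rfl
  · have hz := Complex.isPrimitiveRoot_exp i (by omega)
    exact absurd (h (a₁ := 1) (by simp [hz.pow_eq_one])) (hz.ne_one (by omega)).symm

theorem eq_C_of_forall_eval_ne_zero {k : Polynomial ℂ} (h : ∀ t, k.eval t ≠ 0) :
    ∃ c : ℂ, c ≠ 0 ∧ k = Polynomial.C c := by
  have hk : k.degree = 0 := by
    by_contra hne
    obtain ⟨t, ht⟩ := IsAlgClosed.exists_root k hne
    exact h t ht
  have := Polynomial.eq_C_of_degree_eq_zero hk
  refine ⟨_, fun h0 => h 0 ?_, this⟩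
  rw [this, h0]
  simp

theorem eval_aeval_polynomial {σ : Type*} (x : σ → Polynomial ℂ) (P : MvPolynomial σ ℂ) (t : ℂ) :
    (MvPolynomial.aeval x P).eval t = MvPolynomial.eval (fun i => (x i).eval t) P := by
  induction P using MvPolynomial.induction_on with
  | C a => simp
  | add p q hp hq => simp only [map_add, Polynomial.eval_add, hp, hq]
  | mul_X p i hp => simp only [map_mul, Polynomial.eval_mul, hp, MvPolynomial.aeval_X,
      MvPolynomial.eval_X]

/-- An automorphism of the secant variety that fixes two points of the curve maps the line through
them to itself. -/
theorem aut_standard {d : ℕ} (hd : 4 ≤ d) {φ : Equiv.Perm (secantVariety d)}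
    (hφ : φ ∈ Aut (secantVariety d))
    (h10 : ∀ hu hm, (φ ⟨Projectivization.mk ℂ (veroneseVec d ![1, 0]) hu, hm⟩ :
      ℙ ℂ (Fin (d + 1) → ℂ)) = Projectivization.mk ℂ (veroneseVec d ![1, 0]) hu)
    (h01 : ∀ hu hm, (φ ⟨Projectivization.mk ℂ (veroneseVec d ![0, 1]) hu, hm⟩ :
      ℙ ℂ (Fin (d + 1) → ℂ)) = Projectivization.mk ℂ (veroneseVec d ![0, 1]) hu)
    (hu : veroneseVec d ![0, 1] + veroneseVec d ![1, 0] ≠ 0)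
    (hm : Projectivization.mk ℂ _ hu ∈ secantVariety d) :
    ∃ (u : Fin (d + 1) → ℂ) (hu' : u ≠ 0), (φ ⟨Projectivization.mk ℂ _ hu, hm⟩ :
      ℙ ℂ (Fin (d + 1) → ℂ)) = Projectivization.mk ℂ u hu' ∧ IsSecantVec d u := by
  have hd0 : d ≠ 0 := by omega
  have hd2 : 2 ≤ d := by omega
  have hX : ∀ (v : Fin 3 → ℂ) (hv : (fun k => MvPolynomial.eval v (conePoly d k)) ≠ 0),
      Projectivization.mk ℂ _ hv ∈ secantVariety d := by
    intro v hv
    rw [mk_mem_secantVariety_iff hd2]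
    have hv' : v = ![v 0, v 1, v 2] := by
      funext i
      fin_cases i <;> rfl
    rw [hv', eval_conePoly]
    exact isTangentVec_or_isSecantVec_cone hd0 _ _ _
  obtain ⟨N, F, hF, hlift⟩ := exists_polynomial_lift hφ.1 (isWeightedHomogeneous_conePoly d)
    ⟨![1, 0, 0], by
      rw [eval_conePoly, zero_smul, add_zero]
      exact veroneseVec_ne_zero d (by simp)⟩ hX
  have key : ∀ (x y a : ℂ) (u : Fin (d + 1) → ℂ) (hu : u ≠ 0)
      (hm : Projectivization.mk ℂ u hu ∈ secantVariety d),
      u = veroneseVec d ![x, y] + a • veroneseVec d ![1, 0] →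
        ∃ h : (fun j => MvPolynomial.eval ![x, y, a] (F j)) ≠ 0,
          (φ ⟨Projectivization.mk ℂ u hu, hm⟩ : ℙ ℂ (Fin (d + 1) → ℂ)) =
            Projectivization.mk ℂ _ h := by
    intro x y a u hu hm h
    rw [← eval_conePoly] at h
    subst h
    exact hlift _ hu
  have hne : ∀ x y : ℂ, (![x, y] : Fin 2 → ℂ) ≠ 0 → veroneseVec d ![x, y] ≠ 0 := fun x y h =>
    veroneseVec_ne_zero d h
  have hmem : ∀ (x y : ℂ) (h : (![x, y] : Fin 2 → ℂ) ≠ 0),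
      Projectivization.mk ℂ _ (hne x y h) ∈ secantVariety d := fun x y h => by
    rw [mk_mem_secantVariety_iff hd2]
    have := isTangentVec_smul_veroneseVec hd0 h 1
    rw [one_smul] at this
    exact .inl this
  have hC : ∀ (x y : ℂ), (![x, y] : Fin 2 → ℂ) ≠ 0 →
      ∃ p, (fun j => MvPolynomial.eval ![x, y, 0] (F j)) = veroneseVec d p := by
    intro x y h
    obtain ⟨h', e⟩ := key x y 0 _ (hne x y h) (hmem x y h) (by rw [zero_smul, add_zero])
    have := aut_mem_rationalNormalCurve hd hφ (z := ⟨_, hmem x y h⟩) ⟨_, h, rfl⟩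
    rwa [e, mk_mem_rationalNormalCurve_iff hd0] at this
  have hinj : ∀ (x y : ℂ), (![x, y] : Fin 2 → ℂ) ≠ 0 → ∀ (x' y' : ℂ), (![x', y'] : Fin 2 → ℂ) ≠ 0 →
      ∀ a : ℂ, (fun j => MvPolynomial.eval ![x, y, 0] (F j)) =
        a • (fun j => MvPolynomial.eval ![x', y', 0] (F j)) → x * y' - y * x' = 0 := by
    intro x y h x' y' h' a ha
    obtain ⟨h1, e1⟩ := key x y 0 _ (hne x y h) (hmem x y h) (by rw [zero_smul, add_zero])
    obtain ⟨h2, e2⟩ := key x' y' 0 _ (hne x' y' h') (hmem x' y' h') (by rw [zero_smul, add_zero])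
    have e3 := φ.injective (Subtype.ext (e1.trans
      (((Projectivization.mk_eq_mk_iff' ℂ _ _ h1 h2).2 ⟨a, ha.symm⟩).trans e2.symm)))
    obtain ⟨c, hc⟩ := (Projectivization.mk_eq_mk_iff' ℂ _ _ _ _).1 (congrArg Subtype.val e3)
    simpa using pair_det_eq_zero_of_veroneseVec_eq_smul hd0 hc.symm
  have v10 : (![1, 0] : Fin 2 → ℂ) ≠ 0 := by simp
  have v01 : (![0, 1] : Fin 2 → ℂ) ≠ 0 := by simp
  have v1t : ∀ t : ℂ, (![1, t] : Fin 2 → ℂ) ≠ 0 := fun t => by simp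
  have vt1 : ∀ t : ℂ, (![t, 1] : Fin 2 → ℂ) ≠ 0 := fun t => by simp
  obtain ⟨a, ha0, ha⟩ : ∃ a : ℂ, a ≠ 0 ∧
      (fun j => MvPolynomial.eval ![0, 1, 0] (F j)) = a • veroneseVec d ![0, 1] := by
    obtain ⟨h1, e1⟩ := key 0 1 0 _ (hne 0 1 v01) (hmem 0 1 v01) (by rw [zero_smul, add_zero])
    rw [h01] at e1
    obtain ⟨a, ha⟩ := (Projectivization.mk_eq_mk_iff' ℂ _ _ _ _).1 e1.symm
    exact ⟨a, fun h => h1 (by rw [← ha, h, zero_smul]), ha.symm⟩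
  obtain ⟨b, hb0, hb⟩ : ∃ b : ℂ, b ≠ 0 ∧
      (fun j => MvPolynomial.eval ![0, 0, 1] (F j)) = b • veroneseVec d ![1, 0] := by
    obtain ⟨h1, e1⟩ := key 0 0 1 _ (hne 1 0 v10) (hmem 1 0 v10) (by
      have : (![0, 0] : Fin 2 → ℂ) = 0 := by simp
      rw [this, veroneseVec_zero hd0, one_smul, zero_add])
    rw [h10] at e1
    obtain ⟨a, ha⟩ := (Projectivization.mk_eq_mk_iff' ℂ _ _ _ _).1 e1.symm
    exact ⟨a, fun h => h1 (by rw [← ha, h, zero_smul]), ha.symm⟩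
  obtain ⟨b', hb'⟩ : ∃ b' : ℂ,
      (fun j => MvPolynomial.eval ![1, 0, 0] (F j)) = b' • veroneseVec d ![1, 0] := by
    obtain ⟨h1, e1⟩ := key 1 0 0 _ (hne 1 0 v10) (hmem 1 0 v10) (by rw [zero_smul, add_zero])
    rw [h10] at e1
    obtain ⟨a, ha⟩ := (Projectivization.mk_eq_mk_iff' ℂ _ _ _ _).1 e1.symm
    exact ⟨a, ha.symm⟩
  have hscale : ∀ p : Fin 2 → ℂ, p 0 = 0 → veroneseVec d p = p 1 ^ d • veroneseVec d ![0, 1] := by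
    intro p hp
    rw [← veroneseVec_smul]
    congr 1
    funext i
    fin_cases i <;> simp [hp]
  have hscale' : ∀ p : Fin 2 → ℂ, p 1 = 0 → veroneseVec d p = p 0 ^ d • veroneseVec d ![1, 0] := by
    intro p hp
    rw [← veroneseVec_smul]
    congr 1
    funext i
    fin_cases i <;> simp [hp]
  let k : Fin (d + 1) → Polynomial ℂ := fun j =>
    MvPolynomial.aeval ![1, Polynomial.X, 0] (F j)
  let l : Fin (d + 1) → Polynomial ℂ := fun j =>
    MvPolynomial.aeval ![Polynomial.X, 1, 0] (F j)
  have hk : ∀ j t, (k j).eval t = MvPolynomial.eval ![1, t, 0] (F j) := by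
    intro j t
    rw [eval_aeval_polynomial]
    congr 2
    funext i
    fin_cases i <;> simp
  have hl : ∀ j t, (l j).eval t = MvPolynomial.eval ![t, 1, 0] (F j) := by
    intro j t
    rw [eval_aeval_polynomial]
    congr 2
    funext i
    fin_cases i <;> simp
  have hkp : ∀ t, ∃ p, ∀ j, (k j).eval t = veroneseVec d p j := by
    intro t
    obtain ⟨p, hp⟩ := hC 1 t (v1t t)
    exact ⟨p, fun j => by rw [hk, ← hp]⟩
  -- Only v(0,1) is sent to v(0,1), so coordinate 0 of the image of v(1,t) never vanishes and is
  -- constant in t.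
  obtain ⟨c₁, hc₁, hk0⟩ := eq_C_of_forall_eval_ne_zero (k := k 0) fun t ht => by
    obtain ⟨p, hp⟩ := hC 1 t (v1t t)
    rw [hk, congrFun hp 0] at ht
    have hp0 : p 0 = 0 := by
      simpa [veroneseVec, hd0] using ht
    have := hinj 1 t (v1t t) 0 1 v01 (p 1 ^ d / a) (by
      rw [hp, ha, smul_smul, div_mul_cancel₀ _ ha0, hscale p hp0])
    simp at this
  -- Symmetrically, the last coordinate never vanishes along v(t,1), since only v(1,0) is sent to
  -- v(1,0).
  obtain ⟨c₂, hc₂, hld⟩ := eq_C_of_forall_eval_ne_zero (k := l (Fin.last d)) fun t ht => by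
    obtain ⟨p, hp⟩ := hC t 1 (vt1 t)
    rw [hl, congrFun hp (Fin.last d)] at ht
    have hp0 : p 1 = 0 := by
      simpa [veroneseVec, hd0] using ht
    have hb'0 : b' ≠ 0 := by
      rintro rfl
      have := hinj 1 0 v10 0 1 v01 0 (by rw [hb', zero_smul, zero_smul])
      simp at this
    have := hinj t 1 (vt1 t) 1 0 v10 (p 0 ^ d / b') (by
      rw [hp, hb', smul_smul, div_mul_cancel₀ _ hb'0, hscale' p hp0])
    simp at this
  have hkd : k (Fin.last d) = Polynomial.C c₂ * Polynomial.X ^ N := by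
    -- The extra factor `X` disposes of t = 0, where the rescaling of (t⁻¹,1) to (1,t) is
    -- unavailable.
    refine mul_left_cancel₀ Polynomial.X_ne_zero (Polynomial.funext fun t => ?_)
    simp only [Polynomial.eval_mul, Polynomial.eval_X, Polynomial.eval_C, Polynomial.eval_pow]
    rcases eq_or_ne t 0 with rfl | ht
    · simp
    · congr 1
      have h1 := eval_scale_of_isWeightedHomogeneous (hF (Fin.last d)) t ![t⁻¹, 1, 0]
      have h2 : (fun i => t ^ (![1, 1, d] : Fin 3 → ℕ) i * (![t⁻¹, 1, 0] : Fin 3 → ℂ) i) =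
          ![1, t, 0] := by
        funext i
        fin_cases i <;> simp [ht]
      rw [h2, ← hk, ← hl, hld, Polynomial.eval_C, mul_comm] at h1
      exact h1
  let j₁ : Fin (d + 1) := ⟨1, by omega⟩
  -- On the cone over the curve, x₁^d = x₀^(d−1) x_d.
  have hk1 : k j₁ ^ d = Polynomial.C (c₁ ^ (d - 1) * c₂) * Polynomial.X ^ N := by
    rw [Polynomial.C_mul, Polynomial.C_pow, mul_assoc, ← hkd, ← hk0]
    refine Polynomial.funext fun t => ?_
    obtain ⟨p, hp⟩ := hkp t
    simp only [Polynomial.eval_mul, Polynomial.eval_pow, hp, veroneseVec, j₁, Fin.val_zero,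
      Fin.val_last, Nat.sub_zero, Nat.sub_self, pow_zero, mul_one, one_mul, pow_one]
    rw [mul_pow, ← pow_mul, ← pow_mul, mul_comm d]
  obtain ⟨c, i, hci, hN⟩ := eq_C_mul_X_pow_of_pow_eq (mul_ne_zero (pow_ne_zero _ hc₁) hc₂) hd0 hk1
  -- With x₀ constant, x₁ determines the affine coordinate of the image point, so injectivity of φ
  -- on C makes `k j₁` injective. Hence the weight N is exactly `d`.
  have hi : i = 1 := by
    refine eq_one_of_injective_pow (b := c) fun t t' htt' => ?_
    have h1 : (k j₁).eval t = (k j₁).eval t' := by simpa [hci] using htt'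
    obtain ⟨p, hp⟩ := hkp t
    obtain ⟨p', hp'⟩ := hkp t'
    have e0 : p 0 ^ d = c₁ := by
      have := hp 0
      rw [hk0, Polynomial.eval_C] at this
      simpa [veroneseVec] using this.symm
    have e0' : p' 0 ^ d = c₁ := by
      have := hp' 0
      rw [hk0, Polynomial.eval_C] at this
      simpa [veroneseVec] using this.symm
    have e1 : p 0 ^ (d - 1) * p 1 = p' 0 ^ (d - 1) * p' 1 := by
      rw [hp, hp'] at h1
      simpa [veroneseVec, j₁] using h1
    have hp0 : p 0 ≠ 0 := fun h => hc₁ (by rw [← e0, h, zero_pow hd0])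
    have hp0' : p' 0 ≠ 0 := fun h => hc₁ (by rw [← e0', h, zero_pow hd0])
    have e2 : p 1 / p 0 = p' 1 / p' 0 := by
      have f : ∀ q : Fin 2 → ℂ, q 0 ≠ 0 → q 1 / q 0 = q 0 ^ (d - 1) * q 1 / q 0 ^ d := by
        intro q hq
        rw [← pow_sub_one_mul hd0 (q 0)]
        field_simp
      rw [f p hp0, f p' hp0', e0, e0', e1]
    have e3 : veroneseVec d p = veroneseVec d p' := by
      have f : ∀ q : Fin 2 → ℂ, q 0 ≠ 0 →
          veroneseVec d q = q 0 ^ d • veroneseVec d ![1, q 1 / q 0] := by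
        intro q hq
        rw [← veroneseVec_smul]
        congr 1
        funext i
        fin_cases i
        · simp
        · simp only [Fin.mk_one, Pi.smul_apply, Matrix.cons_val_one, smul_eq_mul,
            Matrix.cons_val_fin_one]
          field_simp
      rw [f p hp0, f p' hp0', e0, e0', e2]
    have := hinj 1 t (v1t t) 1 t' (v1t t') 1 (by
      rw [one_smul]
      funext j
      rw [← hk, ← hk, hp, hp', e3])
    linear_combination -this
  rw [hi, mul_one] at hN
  subst hN
  obtain ⟨h1, e1⟩ := key 0 1 1 _ hu hm (by rw [one_smul])
  refine ⟨_, h1, e1, ?_⟩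
  have hsum : (fun j => MvPolynomial.eval ![0, 1, 1] (F j)) =
      a • veroneseVec N ![0, 1] + b • veroneseVec N ![1, 0] := by
    rw [← ha, ← hb]
    funext j
    exact eval_eq_add_of_isWeightedHomogeneous hd0 (hF j)
  rw [hsum]
  exact isSecantVec_of_smul_add_smul hd0 (by simp) ha0 hb0

/-! ### The orbits of the automorphism group -/

theorem IsSecantVec.smul {d : ℕ} (hd : d ≠ 0) {u : Fin (d + 1) → ℂ} (hu : IsSecantVec d u) {c : ℂ}
    (hc : c ≠ 0) : IsSecantVec d (c • u) := by
  obtain ⟨p, q, hpq, rfl⟩ := hu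
  rw [smul_add]
  exact isSecantVec_of_smul_add_smul hd hpq hc hc

theorem mk_veroneseVec_mem_secantVariety {d : ℕ} (hd : 2 ≤ d) {p : Fin 2 → ℂ} (hp : p ≠ 0) :
    Projectivization.mk ℂ (veroneseVec d p) (veroneseVec_ne_zero d hp) ∈ secantVariety d := by
  rw [mk_mem_secantVariety_iff hd]
  have := isTangentVec_smul_veroneseVec (by omega : d ≠ 0) hp 1
  rw [one_smul] at this
  exact .inl this

/-- Automorphisms of the secant variety preserve the complement of the tangent developable. -/
theorem aut_isSecantVec {d : ℕ} (hd : 4 ≤ d) {φ : Equiv.Perm (secantVariety d)}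
    (hφ : φ ∈ Aut (secantVariety d)) {u u' : Fin (d + 1) → ℂ} (hu : u ≠ 0) (hu' : u' ≠ 0)
    (hm : Projectivization.mk ℂ u hu ∈ secantVariety d)
    (h : (φ ⟨_, hm⟩ : ℙ ℂ (Fin (d + 1) → ℂ)) = Projectivization.mk ℂ u' hu')
    (hs : IsSecantVec d u) : IsSecantVec d u' := by
  have hd0 : d ≠ 0 := by omega
  have hd2 : 2 ≤ d := by omega
  obtain ⟨p, q, hpq, rfl⟩ := hs
  have hp : p ≠ 0 := by rintro rfl; simp at hpq
  have hq : q ≠ 0 := by rintro rfl; simp at hpq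
  have image : ∀ r (hr : r ≠ 0), ∃ r', ∃ hr' : r' ≠ 0,
      (φ ⟨_, mk_veroneseVec_mem_secantVariety hd2 hr⟩ : ℙ ℂ (Fin (d + 1) → ℂ)) =
        Projectivization.mk ℂ (veroneseVec d r') (veroneseVec_ne_zero d hr') := fun r hr =>
    aut_mem_rationalNormalCurve hd hφ (z := ⟨_, mk_veroneseVec_mem_secantVariety hd2 hr⟩)
      ⟨r, hr, rfl⟩
  obtain ⟨p', hp', hφp⟩ := image p hp
  obtain ⟨q', hq', hφq⟩ := image q hq
  have hpq' : p' 0 * q' 1 - p' 1 * q' 0 ≠ 0 := by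
    intro h0
    obtain ⟨c, rfl⟩ := exists_smul_of_pair_det_eq_zero hp' h0
    have e : (φ ⟨_, mk_veroneseVec_mem_secantVariety hd2 hq⟩ : ℙ ℂ (Fin (d + 1) → ℂ)) =
        φ ⟨_, mk_veroneseVec_mem_secantVariety hd2 hp⟩ := by
      rw [hφp, hφq, Projectivization.mk_eq_mk_iff']
      exact ⟨c ^ d, (veroneseVec_smul d c p').symm⟩
    obtain ⟨a, ha⟩ := (Projectivization.mk_eq_mk_iff' ℂ _ _ _ _).1
      (congrArg Subtype.val (φ.injective (Subtype.ext e)))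
    refine hpq ?_
    linear_combination -pair_det_eq_zero_of_veroneseVec_eq_smul hd0 ha.symm
  obtain ⟨g, k, hgk, hgp, hgq⟩ := exists_matrix_pair hpq
  obtain ⟨g', k', hgk', hgp', hgq'⟩ := exists_matrix_pair hpq'
  obtain ⟨A, χ, hA, -, -, hχ⟩ := exists_aut_of_matrix hd2 hgk
  obtain ⟨A', χ', hA', -, hS', hχ'⟩ := exists_aut_of_matrix hd2 hgk'
  have hback : ∀ (x y : Fin (d + 1) → ℂ) (hx : x ≠ 0) (hy : y ≠ 0) (hxm hym), A x = y →
      χ.1.symm ⟨Projectivization.mk ℂ y hy, hym⟩ = ⟨Projectivization.mk ℂ x hx, hxm⟩ := by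
    rintro x _ hx hy hxm hym rfl
    rw [Equiv.symm_apply_eq]
    exact Subtype.ext (hχ ⟨_, hxm⟩).symm
  -- Moving both pairs of curve points, before and after φ, to the standard pair gives an
  -- automorphism that fixes v(1,0) and v(0,1).
  let ψ : Equiv.Perm (secantVariety d) := χ'.1 * φ * χ.1⁻¹
  have hψ : ψ ∈ Aut (secantVariety d) :=
    mul_mem (mul_mem χ'.2 hφ) (inv_mem χ.2)
  have hψa : ∀ z, ψ z = χ'.1 (φ (χ.1.symm z)) := fun z => rfl
  have hne : veroneseVec d ![0, 1] + veroneseVec d ![1, 0] ≠ 0 :=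
    (IsSecantVec.ne_zero hd0 ⟨![0, 1], ![1, 0], by simp, rfl⟩)
  have hmem : Projectivization.mk ℂ _ hne ∈ secantVariety d :=
    (mk_mem_secantVariety_iff hd2 hne).2 (.inr ⟨![0, 1], ![1, 0], by simp, rfl⟩)
  obtain ⟨x, hx, hψx, hsec⟩ := aut_standard hd hψ
    (fun h1 h2 => by
      rw [hψa, hback _ _ (veroneseVec_ne_zero d hp) h1 (mk_veroneseVec_mem_secantVariety hd2 hp) h2
        (by rw [hA, hgp]), hχ', hφp, Projectivization.map_mk]
      congr 1
      exact (hA' _).trans (by rw [hgp']))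
    (fun h1 h2 => by
      rw [hψa, hback _ _ (veroneseVec_ne_zero d hq) h1 (mk_veroneseVec_mem_secantVariety hd2 hq) h2
        (by rw [hA, hgq]), hχ', hφq, Projectivization.map_mk]
      congr 1
      exact (hA' _).trans (by rw [hgq'])) hne hmem
  rw [hψa, hback _ _ hu hne hm hmem (by rw [map_add, hA, hA, hgp, hgq]; exact add_comm _ _), hχ', h,
    Projectivization.map_mk, Projectivization.mk_eq_mk_iff] at hψx
  obtain ⟨c, hc⟩ := hψx
  rw [← hS']
  have := hsec.smul hd0 c.ne_zero
  rwa [← Units.smul_def, hc] at this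

theorem image_orbit_eq {ι : Type*} {X s : Set (ℙ ℂ (ι → ℂ))} {b : ℙ ℂ (ι → ℂ)} (hs : s ⊆ X)
    (htrans : ∀ z : X, (z : ℙ ℂ (ι → ℂ)) ∈ s → ∃ φ : Aut X, (φ.1 z : ℙ ℂ (ι → ℂ)) = b)
    (hinv : ∀ (φ : Aut X) (z : X), (z : ℙ ℂ (ι → ℂ)) ∈ s → (φ.1 z : ℙ ℂ (ι → ℂ)) ∈ s) (z : X)
    (hz : (z : ℙ ℂ (ι → ℂ)) ∈ s) : Subtype.val '' MulAction.orbit (Aut X) z = s := by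
  ext y
  constructor
  · rintro ⟨_, ⟨φ, rfl⟩, rfl⟩
    exact hinv φ z hz
  · intro hy
    obtain ⟨φ, hφ⟩ := htrans z hz
    obtain ⟨ψ, hψ⟩ := htrans ⟨y, hs hy⟩ hy
    refine ⟨⟨y, hs hy⟩, ⟨ψ⁻¹ * φ, ?_⟩, rfl⟩
    show ψ.1.symm (φ.1 z) = _
    rw [Equiv.symm_apply_eq]
    exact Subtype.ext (hφ.trans hψ.symm)

theorem mk_mem_diff_tangentDevelopable_iff {d : ℕ} (hd : 3 ≤ d) {u : Fin (d + 1) → ℂ} (hu : u ≠ 0) :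
    Projectivization.mk ℂ u hu ∈ secantVariety d \ tangentDevelopable d ↔ IsSecantVec d u := by
  rw [Set.mem_sdiff, mk_mem_secantVariety_iff (by omega), mk_mem_tangentDevelopable_iff]
  constructor
  · rintro ⟨h | h, h'⟩
    · exact absurd h h'
    · exact h
  · intro h
    exact ⟨.inr h, h.not_isTangentVec hd⟩

theorem aut_mem_diff_tangentDevelopable {d : ℕ} (hd : 4 ≤ d) (φ : Aut (secantVariety d))
    (z : secantVariety d)
    (hz : (z : ℙ ℂ (Fin (d + 1) → ℂ)) ∈ secantVariety d \ tangentDevelopable d) :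
    (φ.1 z : ℙ ℂ (Fin (d + 1) → ℂ)) ∈ secantVariety d \ tangentDevelopable d := by
  obtain ⟨z, hzm⟩ := z
  induction z using Projectivization.ind with
  | h u hu =>
    have e := (Projectivization.mk_rep (φ.1 ⟨_, hzm⟩ : ℙ ℂ (Fin (d + 1) → ℂ))).symm
    rw [mk_mem_diff_tangentDevelopable_iff (by omega)] at hz
    rw [e, mk_mem_diff_tangentDevelopable_iff (by omega)]
    exact aut_isSecantVec hd φ.2 hu _ hzm e hz

/-- The inverse automorphism preserves C and Σ \ T, so no point of the remaining stratum can enter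
either of them. -/
theorem aut_mem_tangentDevelopable_diff {d : ℕ} (hd : 4 ≤ d) (φ : Aut (secantVariety d))
    (z : secantVariety d)
    (hz : (z : ℙ ℂ (Fin (d + 1) → ℂ)) ∈ tangentDevelopable d \ rationalNormalCurve d) :
    (φ.1 z : ℙ ℂ (Fin (d + 1) → ℂ)) ∈ tangentDevelopable d \ rationalNormalCurve d := by
  have hback : (φ⁻¹ : Aut (secantVariety d)).1 (φ.1 z) = z := φ.1.symm_apply_apply z
  constructor
  · by_contra h
    have := aut_mem_diff_tangentDevelopable hd φ⁻¹ (φ.1 z) ⟨(φ.1 z).2, h⟩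
    rw [hback] at this
    exact this.2 hz.1
  · intro h
    have := aut_mem_rationalNormalCurve hd (φ⁻¹).2 h
    rw [hback] at this
    exact hz.2 this

theorem exists_aut_rationalNormalCurve {d : ℕ} (hd : 2 ≤ d) (z : secantVariety d)
    (hz : (z : ℙ ℂ (Fin (d + 1) → ℂ)) ∈ rationalNormalCurve d) :
    ∃ φ : Aut (secantVariety d), (φ.1 z : ℙ ℂ (Fin (d + 1) → ℂ)) =
      Projectivization.mk ℂ (veroneseVec d ![1, 0]) (veroneseVec_ne_zero d (by simp)) := by
  obtain ⟨z, hzm⟩ := z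
  obtain ⟨p, hp, rfl⟩ := hz
  obtain ⟨q, hpq⟩ := exists_pair_det_ne_zero hp
  obtain ⟨g, h, hgh, hgp, -⟩ := exists_matrix_pair hpq
  obtain ⟨A, φ, hA, -, -, hφ⟩ := exists_aut_of_matrix hd hgh
  refine ⟨φ, ?_⟩
  rw [hφ, Projectivization.map_mk]
  congr 1
  exact (hA p).trans (by rw [hgp])

theorem tangentVec_standard_ne_zero {d : ℕ} (hd : d ≠ 0) : tangentVec d ![1, 0] ![0, 1] ≠ 0 := by
  rw [tangentVec_one_zero hd]
  simp

theorem mk_tangentVec_mem_tangentDevelopable_diff {d : ℕ} (hd : 2 ≤ d) :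
    Projectivization.mk ℂ _ (tangentVec_standard_ne_zero (by omega : d ≠ 0)) ∈
      tangentDevelopable d \ rationalNormalCurve d := by
  have hd0 : d ≠ 0 := by omega
  rw [Set.mem_sdiff, mk_mem_tangentDevelopable_iff, mk_mem_rationalNormalCurve_iff hd0]
  refine ⟨⟨_, by simp, _, rfl⟩, ?_⟩
  rintro ⟨p, hp⟩
  rw [tangentVec_one_zero hd0] at hp
  have h0 := congrFun hp 0
  have h1 := congrFun hp ⟨1, by omega⟩
  have e : d - 1 ≠ 0 := by omega
  have hp0 : p 0 = 0 := by
    have h0' : 0 = p 0 ^ d := by simpa [veroneseVec, Pi.single_apply, Fin.ext_iff] using h0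
    exact eq_zero_of_pow_eq_zero h0'.symm
  simp [veroneseVec, hp0, e] at h1

theorem exists_aut_tangentDevelopable {d : ℕ} (hd : 2 ≤ d) (z : secantVariety d)
    (hz : (z : ℙ ℂ (Fin (d + 1) → ℂ)) ∈ tangentDevelopable d \ rationalNormalCurve d) :
    ∃ φ : Aut (secantVariety d), (φ.1 z : ℙ ℂ (Fin (d + 1) → ℂ)) =
      Projectivization.mk ℂ _ (tangentVec_standard_ne_zero (by omega : d ≠ 0)) := by
  have hd0 : d ≠ 0 := by omega
  obtain ⟨z, hzm⟩ := z
  induction z using Projectivization.ind with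
  | h u hu =>
    rw [Set.mem_sdiff, mk_mem_tangentDevelopable_iff, mk_mem_rationalNormalCurve_iff hd0] at hz
    obtain ⟨⟨p, hp, w, rfl⟩, hC⟩ := hz
    have hpw : p 0 * w 1 - p 1 * w 0 ≠ 0 := by
      intro h0
      obtain ⟨c, rfl⟩ := exists_smul_of_pair_det_eq_zero hp h0
      obtain ⟨b, hb, -⟩ := exists_veroneseVec_eq_smul hd0 (c * d) p
      exact hC ⟨b • p, by rw [← hb, tangentVec_smul, tangentVec_self, smul_smul]⟩
    obtain ⟨g, h, hgh, hgp, hgw⟩ := exists_matrix_pair hpw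
    obtain ⟨A, φ, hA, -, -, hφ⟩ := exists_aut_of_matrix hd hgh
    refine ⟨φ, ?_⟩
    rw [hφ, Projectivization.map_mk]
    congr 1
    exact (map_tangentVec (A := A.toLinearMap) hA p w).trans (by rw [hgp, hgw])

theorem isSecantVec_standard (d : ℕ) :
    IsSecantVec d (veroneseVec d ![1, 0] + veroneseVec d ![0, 1]) :=
  ⟨![1, 0], ![0, 1], by simp, rfl⟩

theorem exists_aut_diff_tangentDevelopable {d : ℕ} (hd : 3 ≤ d) (z : secantVariety d)
    (hz : (z : ℙ ℂ (Fin (d + 1) → ℂ)) ∈ secantVariety d \ tangentDevelopable d) :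
    ∃ φ : Aut (secantVariety d), (φ.1 z : ℙ ℂ (Fin (d + 1) → ℂ)) =
      Projectivization.mk ℂ _ ((isSecantVec_standard d).ne_zero (by omega)) := by
  obtain ⟨z, hzm⟩ := z
  induction z using Projectivization.ind with
  | h u hu =>
    rw [mk_mem_diff_tangentDevelopable_iff hd] at hz
    obtain ⟨p, q, hpq, rfl⟩ := hz
    obtain ⟨g, h, hgh, hgp, hgq⟩ := exists_matrix_pair hpq
    obtain ⟨A, φ, hA, -, -, hφ⟩ := exists_aut_of_matrix (by omega : 2 ≤ d) hgh
    refine ⟨φ, ?_⟩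
    rw [hφ, Projectivization.map_mk]
    congr 1
    exact (map_add A _ _).trans (by rw [hA, hA, hgp, hgq])

theorem rationalNormalCurve_subset_tangentDevelopable {d : ℕ} (hd : d ≠ 0) :
    rationalNormalCurve d ⊆ tangentDevelopable d := by
  rintro _ ⟨p, hp, rfl⟩
  rw [mk_mem_tangentDevelopable_iff]
  have := isTangentVec_smul_veroneseVec hd hp 1
  rwa [one_smul] at this

theorem tangentDevelopable_subset_secantVariety {d : ℕ} (hd : 2 ≤ d) :
    tangentDevelopable d ⊆ secantVariety d := by
  intro z hz
  induction z using Projectivization.ind with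
  | h u hu =>
    rw [mk_mem_tangentDevelopable_iff] at hz
    exact (mk_mem_secantVariety_iff hd hu).2 (.inl hz)

end SecantRNC

end

theorem proposition2p5 (d : ℕ) (hd : 4 ≤ d) :
    SecantRNC.autOrbits (SecantRNC.secantVariety d) =
        {SecantRNC.rationalNormalCurve d,
          SecantRNC.tangentDevelopable d \ SecantRNC.rationalNormalCurve d,
          SecantRNC.secantVariety d \ SecantRNC.tangentDevelopable d} ∧
      (SecantRNC.autOrbits (SecantRNC.secantVariety d)).ncard = 3 := by
  have hCT := SecantRNC.rationalNormalCurve_subset_tangentDevelopable (by omega : d ≠ 0)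
  have hTS := SecantRNC.tangentDevelopable_subset_secantVariety (by omega : 2 ≤ d)
  have orbC := SecantRNC.image_orbit_eq (hCT.trans hTS)
    (SecantRNC.exists_aut_rationalNormalCurve (by omega))
    fun φ _ h => SecantRNC.aut_mem_rationalNormalCurve hd φ.2 h
  have orbT := SecantRNC.image_orbit_eq (Set.sdiff_subset.trans hTS)
    (SecantRNC.exists_aut_tangentDevelopable (by omega))
    (SecantRNC.aut_mem_tangentDevelopable_diff hd)
  have orbS := SecantRNC.image_orbit_eq Set.sdiff_subset
    (SecantRNC.exists_aut_diff_tangentDevelopable (by omega))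
    (SecantRNC.aut_mem_diff_tangentDevelopable hd)
  -- Points of the strata are needed both to realize each stratum as an orbit and to show that these
  -- disjoint sets are distinct.
  obtain ⟨x, hx⟩ : (SecantRNC.rationalNormalCurve d).Nonempty := ⟨_, ![1, 0], by simp, rfl⟩
  obtain ⟨y, hy⟩ : (SecantRNC.tangentDevelopable d \ SecantRNC.rationalNormalCurve d).Nonempty :=
    ⟨_, SecantRNC.mk_tangentVec_mem_tangentDevelopable_diff (by omega)⟩
  obtain ⟨z, hz⟩ : (SecantRNC.secantVariety d \ SecantRNC.tangentDevelopable d).Nonempty :=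
    ⟨_, (SecantRNC.mk_mem_diff_tangentDevelopable_iff (by omega)
      ((SecantRNC.isSecantVec_standard d).ne_zero (by omega))).2
        (SecantRNC.isSecantVec_standard d)⟩
  have main : SecantRNC.autOrbits (SecantRNC.secantVariety d) =
      {SecantRNC.rationalNormalCurve d,
        SecantRNC.tangentDevelopable d \ SecantRNC.rationalNormalCurve d,
        SecantRNC.secantVariety d \ SecantRNC.tangentDevelopable d} := by
    ext s
    simp only [SecantRNC.autOrbits, Set.mem_range, Set.mem_insert_iff, Set.mem_singleton_iff]
    constructor
    · rintro ⟨p, rfl⟩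
      by_cases hT : (p : ℙ ℂ (Fin (d + 1) → ℂ)) ∈ SecantRNC.tangentDevelopable d
      · by_cases hC : (p : ℙ ℂ (Fin (d + 1) → ℂ)) ∈ SecantRNC.rationalNormalCurve d
        · exact .inl (orbC p hC)
        · exact .inr (.inl (orbT p ⟨hT, hC⟩))
      · exact .inr (.inr (orbS p ⟨p.2, hT⟩))
    · rintro (rfl | rfl | rfl)
      · exact ⟨⟨x, hTS (hCT hx)⟩, orbC _ hx⟩
      · exact ⟨⟨y, hTS hy.1⟩, orbT _ hy⟩
      · exact ⟨⟨z, hz.1⟩, orbS _ hz⟩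
  refine ⟨main, ?_⟩
  rw [main]
  refine Set.ncard_eq_three.2 ⟨_, _, _, ?_, ?_, ?_, rfl⟩
  · intro h
    exact hy.2 (h ▸ hy)
  · intro h
    exact hz.2 (hCT (h ▸ hz))
  · intro h
    exact hz.2 (h ▸ hz : z ∈ SecantRNC.tangentDevelopable d \ SecantRNC.rationalNormalCurve d).1
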